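/- A *triangle-pentagon complex* $X$ of a graph $G$ is a two-dimensional cell complex with $1$-skeleton $G$ whose $2$-cells are solid triangles and pentagons glued along triangles and along pentagons without diagonals of $G$, and which has no full (i.e. induced) $4$-cycles. Let $X^\star$ be the $2$-dimensional simplicial complex obtained from $X$ by adding a new vertex (the center) for each pentagon, joining it to the five vertices of the pentagon, and thereby replacing each pentagon by five triangles. Let $X$ be endowed with a piecewise Euclidean metric $d$: each $2$-cell is a nondegenerate (strictly convex) Euclidean triangle or pentagon, edge lengths agree on common edges, and $d$ is the induced length metric (the infimum of the lengths of broken paths through cells). Assume that $d$ is a CAT(0) metric, i.e. $(X,d)$ is a geodesic metric space all of whose geodesic triangles satisfy the CAT(0) inequality. Call a vertex $v$ of $X$ *interior* if there is a nonempty family $F$ of $2$-cells containing $v$ that closes up around $v$: every edge at $v$ of a member of $F$ is an edge of at least two members of $F$. (For example, this holds if $v$ lies on a $2$-cell and no edge at $v$ lies in exactly one $2$-cell.) Let $X^\star$ be endowed with a piecewise Euclidean metric $d^\star$ such that - each of the five triangles into which a pentagon is subdivided has angle $\frac{2\pi}{5}$ at the center, angles $\frac{3\pi}{10}$ at its other two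 vertices, and outer edge of length $1$; - each triangle of $X$ is equilateral in $X^\star$; - $d^\star$ agrees with $d$ at the vertices of $X$ in the sense that, for every interior vertex $w$ of $X$, the sum of the angles around $w$ in $(X^\star,d^\star)$ equals the sum of the angles around $w$ in $(X,d)$. Then for every interior vertex $v$ of $X$ that is a vertex of a pentagon of $X$, the combinatorial girth of $v$ in $X^\star$, i.e. the number (possibly infinite) of edges of the link $X^\star_v$, is at least $7$. -/

import Mathlib

/-- The Euclidean plane. -/
abbrev EPlane : Type := EuclideanSpace ℝ (Fin 2)

/-! ### CAT(0) spaces -/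

/-- `γ`, restricted to `[0, 1]`, is a geodesic from `x` to `y`, parametrized proportionally to
arc length. -/
def IsGeodesic {M : Type*} [MetricSpace M] (x y : M) (γ : ℝ → M) : Prop :=
  γ 0 = x ∧ γ 1 = y ∧
    ∀ s ∈ Set.Icc (0 : ℝ) 1, ∀ t ∈ Set.Icc (0 : ℝ) 1, dist (γ s) (γ t) = |s - t| * dist x y

/-- A geodesic space all of whose geodesic triangles satisfy the CAT(0) inequality. Two points on
different sides of a triangle lie on two sides with a common endpoint, which is called `p` here;
as `p`, `q`, `r`, `α`, `β` are arbitrary, all pairs of sides are covered. (For two points on the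
same side the inequality is an equality.) -/
structure IsCAT0 (M : Type*) [MetricSpace M] : Prop where
  exists_geodesic : ∀ x y : M, ∃ γ : ℝ → M, IsGeodesic x y γ
  comparison : ∀ (p q r : M) (α β : ℝ → M), IsGeodesic p q α → IsGeodesic p r β →
    ∀ p' q' r' : EPlane, dist p' q' = dist p q → dist p' r' = dist p r → dist q' r' = dist q r →
      ∀ s ∈ Set.Icc (0 : ℝ) 1, ∀ t ∈ Set.Icc (0 : ℝ) 1,
        dist (α s) (β t) ≤
          dist (AffineMap.lineMap p' q' s : EPlane) (AffineMap.lineMap p' r' t : EPlane)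

/-! ### Links in simplicial complexes -/

/-- The faces of the link of the simplex `σ` in `K`: the simplices of `K` that are disjoint from
`σ` and that span a simplex of `K` together with `σ`. -/
def linkFaces {ι : Type*} (K : AbstractSimplicialComplex ι) (σ : Finset ι) : Set (Finset ι) :=
  {τ | τ ∈ K.faces ∧ Disjoint σ τ ∧ ∃ ρ ∈ K.faces, (ρ : Set ι) = (σ : Set ι) ∪ (τ : Set ι)}

/-- The combinatorial girth of a vertex: the number of edges of its link. -/
noncomputable def combinatorialGirth {ι : Type*} (K : AbstractSimplicialComplex ι) (v : ι) : ℕ∞ :=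
  {τ | τ ∈ linkFaces K {v} ∧ τ.card = 2}.encard

/-! ### Two-dimensional cell complexes made of triangles and pentagons -/

/-- A two-dimensional cell complex with 1-skeleton `graph`, whose 2-cells are solid triangles and
pentagons glued along triangles and pentagons without diagonals of the graph. A 2-cell is recorded
by its set of vertices, which determines its boundary: two vertices of a 2-cell are adjacent if and
only if they are joined by an edge of the boundary of the 2-cell. -/
structure PolygonComplex (V : Type*) where
  graph : SimpleGraph V
  triangles : Set (Finset V)
  pentagons : Set (Finset V)
  triangles_isClique : ∀ t ∈ triangles, graph.IsNClique 3 t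
  pentagons_induced : ∀ p ∈ pentagons,
    ∃ f : SimpleGraph.cycleGraph 5 ↪g graph, Finset.univ.map f.toEmbedding = p

/-- A triangle-pentagon complex: moreover there are no full 4-cycles. -/
structure TrianglePentagonComplex (V : Type*) extends PolygonComplex V where
  no_full_four_cycle : IsEmpty (SimpleGraph.cycleGraph 4 ↪g graph)

namespace PolygonComplex

variable {V : Type*}

/-- The 2-cells. -/
def twoCells (K : PolygonComplex V) : Set (Finset V) := K.triangles ∪ K.pentagons

/-- All cells (vertices, edges, triangles, pentagons), given by their vertex sets. -/
def cells (K : PolygonComplex V) : Set (Finset V) :=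
  {c | c.card = 1 ∨ K.graph.IsNClique 2 c ∨ c ∈ K.triangles ∨ c ∈ K.pentagons}

/-- `v` is an interior vertex: some nonempty family `F` of 2-cells at `v` closes up around `v`,
that is, every edge at `v` of a member of `F` is an edge of at least two members of `F`. -/
def IsInterior (K : PolygonComplex V) (v : V) : Prop :=
  ∃ F : Set (Finset V), F.Nonempty ∧ (∀ c ∈ F, c ∈ K.twoCells ∧ v ∈ c) ∧
    ∀ c ∈ F, ∀ w ∈ c, K.graph.Adj v w → ∃ c' ∈ F, c' ≠ c ∧ w ∈ c'

/-- A piecewise Euclidean structure: every cell `c` is realized as the convex hull of points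
`pos c a` of the plane, `a ∈ c`, such that these points are, for a 2-cell, the vertices of a
nondegenerate strictly convex polygon whose sides correspond to the boundary edges of the cell
(every side line has all other vertices strictly on one side), and such that the length of an edge
does not depend on the cell in which it is measured. Values of `pos c` outside `c` are
irrelevant. -/
structure EuclideanStructure (K : PolygonComplex V) where
  pos : Finset V → V → EPlane
  injOn : ∀ c ∈ K.cells, Set.InjOn (pos c) (c : Set V)
  strictConvex : ∀ c ∈ K.cells, ∀ a ∈ c, ∀ b ∈ c, K.graph.Adj a b →
    ∀ x ∈ c, ∀ y ∈ c, x ≠ a → x ≠ b → y ≠ a → y ≠ b →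
      (affineSpan ℝ {pos c a, pos c b}).SSameSide (pos c x) (pos c y)
  length_eq : ∀ c ∈ K.cells, ∀ c' ∈ K.cells, ∀ a b : V, K.graph.Adj a b →
    a ∈ c → b ∈ c → a ∈ c' → b ∈ c' →
      dist (pos c a) (pos c b) = dist (pos c' a) (pos c' b)

namespace EuclideanStructure

variable {K : PolygonComplex V}

/-- The Euclidean cell realizing `c`. -/
def carrier (E : K.EuclideanStructure) (c : Finset V) : Set EPlane :=
  convexHull ℝ (E.pos c '' (c : Set V))

/-- The disjoint union of all Euclidean cells. -/
def PrePoint (E : K.EuclideanStructure) : Type _ := Σ c : K.cells, E.carrier c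

/-- The points with the same parameter on a common edge (or at a common vertex, `a = b`) of two
cells are identified. -/
def Glued (E : K.EuclideanStructure) (x y : E.PrePoint) : Prop :=
  ∃ a b : V, (a = b ∨ K.graph.Adj a b) ∧
    a ∈ x.1.1 ∧ b ∈ x.1.1 ∧ a ∈ y.1.1 ∧ b ∈ y.1.1 ∧
    ∃ t ∈ Set.Icc (0 : ℝ) 1,
      (x.2 : EPlane) = AffineMap.lineMap (E.pos x.1 a) (E.pos x.1 b) t ∧
      (y.2 : EPlane) = AffineMap.lineMap (E.pos y.1 a) (E.pos y.1 b) t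

/-- The geometric realization: the Euclidean cells glued along their faces. -/
def Realization (E : K.EuclideanStructure) : Type _ := Quot E.Glued

/-- The canonical map from a Euclidean cell to the realization. -/
def toPoint (E : K.EuclideanStructure) (c : K.cells) (x : E.carrier c) : E.Realization :=
  Quot.mk E.Glued ⟨c, x⟩

/-- The Euclidean distance of two points inside a common cell (the least one, if there are several
common cells; `∞` if there is none). -/
noncomputable def cellEDist (E : K.EuclideanStructure) (P Q : E.Realization) : ENNReal :=
  ⨅ (c : K.cells) (x : E.carrier c) (y : E.carrier c) (_ : E.toPoint c x = P) (_ : E.toPoint c y = Q),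
    edist (x : EPlane) (y : EPlane)

/-- The intrinsic distance: the infimum of the lengths of the finite strings of points from `P` to
`Q` in which consecutive points lie in a common cell. -/
noncomputable def intrinsicEDist (E : K.EuclideanStructure) (P Q : E.Realization) : ENNReal :=
  ⨅ (n : ℕ) (u : ℕ → E.Realization) (_ : u 0 = P) (_ : u n = Q),
    ∑ i ∈ Finset.range n, E.cellEDist (u i) (u (i + 1))

/-- The angle at the vertex `v` of the 2-cell `c`. (The supremum is over the two neighbours of `v`
in `c`; taking one of them twice contributes the angle `0`.) -/
noncomputable def cornerAngle (E : K.EuclideanStructure) (c : Finset V) (v : V) : ENNReal :=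
  ⨆ (a ∈ c) (b ∈ c) (_ : K.graph.Adj v a) (_ : K.graph.Adj v b),
    ENNReal.ofReal (EuclideanGeometry.angle (E.pos c a) (E.pos c v) (E.pos c b))

/-- The sum of the angles at `v` of all 2-cells that contain `v`. -/
noncomputable def angleSum (E : K.EuclideanStructure) (v : V) : ENNReal :=
  ∑' c : {c : Finset V // c ∈ K.twoCells ∧ v ∈ c}, E.cornerAngle c v

end EuclideanStructure

/-- A complex without pentagons, as an abstract simplicial complex. -/
def toSimplicial (K : PolygonComplex V) (hK : K.pentagons = ∅) : AbstractSimplicialComplex V where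
  faces := K.cells
  isRelLowerSet_faces := by
    classical
    intro s hs
    have hcl : K.graph.IsClique (s : Set V) ∧ s.Nonempty ∧
        (s.card ≤ 2 ∨ s ∈ K.triangles ∧ s.card = 3) := by
      rcases hs with h | h | h | h
      · obtain ⟨a, rfl⟩ := Finset.card_eq_one.1 h
        simp
      · exact ⟨h.isClique, Finset.card_pos.1 (by rw [h.card_eq]; omega), Or.inl h.card_eq.le⟩
      · have h3 := K.triangles_isClique s h
        exact ⟨h3.isClique, Finset.card_pos.1 (by rw [h3.card_eq]; omega), Or.inr ⟨h, h3.card_eq⟩⟩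
      · rw [hK] at h
        exact h.elim
    refine ⟨hcl.2.1, fun t hts ht => ?_⟩
    have hpos := Finset.card_pos.2 ht
    have hle := Finset.card_le_card hts
    by_cases hEq : t = s
    · exact hEq ▸ hs
    have hlt := Finset.card_lt_card (lt_of_le_of_ne hts hEq)
    have h12 : t.card = 1 ∨ t.card = 2 := by omega
    rcases h12 with h | h
    · exact Or.inl h
    · exact Or.inr (Or.inl ⟨hcl.1.subset (Finset.coe_subset.2 hts), h⟩)
  singleton_mem := fun v => Or.inl (Finset.card_singleton v)

end PolygonComplex

namespace TrianglePentagonComplex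

variable {V : Type*}

/-- The vertex set of the subdivision: the vertices together with one centre for each pentagon. -/
abbrev StarVertex (X : TrianglePentagonComplex V) : Type _ := V ⊕ X.pentagons

/-- The 1-skeleton of the subdivision: the edges of `X`, and the edges that join the centre of a
pentagon to the vertices of the pentagon. -/
def starGraph (X : TrianglePentagonComplex V) : SimpleGraph X.StarVertex where
  Adj
    | Sum.inl a, Sum.inl b => X.graph.Adj a b
    | Sum.inl a, Sum.inr p => a ∈ p.1
    | Sum.inr p, Sum.inl a => a ∈ p.1
    | Sum.inr _, Sum.inr _ => False
  symm := ⟨by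
    rintro (a | p) (b | q) h
    · exact X.graph.adj_symm h
    · exact h
    · exact h
    · exact h⟩
  loopless := ⟨by
    rintro (a | p) h
    · exact X.graph.loopless.irrefl a h
    · exact h⟩

open Classical in
/-- A triangle of `X`, as a triangle of the subdivision. -/
noncomputable def oldTriangle (X : TrianglePentagonComplex V) (t : Finset V) :
    Finset X.StarVertex :=
  t.image Sum.inl

open Classical in
/-- The triangle spanned by the centre of the pentagon `p` and by `a`, `b`. -/
noncomputable def wheelTriangle (X : TrianglePentagonComplex V) (p : X.pentagons) (a b : V) :
    Finset X.StarVertex :=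
  {Sum.inr p, Sum.inl a, Sum.inl b}

/-- The complex `X*`: every pentagon of `X` is subdivided into five triangles by means of its
centre. -/
def star (X : TrianglePentagonComplex V) : PolygonComplex X.StarVertex where
  graph := X.starGraph
  triangles := {τ | (∃ t ∈ X.triangles, τ = X.oldTriangle t) ∨
    ∃ (p : X.pentagons) (a b : V), a ∈ p.1 ∧ b ∈ p.1 ∧ X.graph.Adj a b ∧
      τ = X.wheelTriangle p a b}
  pentagons := ∅
  triangles_isClique := by
    classical
    rintro τ (⟨t, ht, rfl⟩ | ⟨p, a, b, ha, hb, hab, rfl⟩)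
    · have h := X.triangles_isClique t ht
      refine ⟨?_, ?_⟩
      · intro x hx y hy hxy
        simp only [oldTriangle, Finset.coe_image, Set.mem_image] at hx hy
        obtain ⟨a, ha, rfl⟩ := hx
        obtain ⟨b, hb, rfl⟩ := hy
        exact h.isClique ha hb fun e => hxy (congrArg Sum.inl e)
      · unfold oldTriangle
        rw [Finset.card_image_of_injective _ Sum.inl_injective, h.card_eq]
    · have h : X.starGraph.IsNClique 3 {Sum.inr p, Sum.inl a, Sum.inl b} :=
        SimpleGraph.is3Clique_triple_iff.2 ⟨ha, hb, hab⟩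
      unfold wheelTriangle
      convert h
  pentagons_induced := fun _ h => h.elim

/-- `X*` as an abstract simplicial complex. -/
def starComplex (X : TrianglePentagonComplex V) : AbstractSimplicialComplex X.StarVertex :=
  X.star.toSimplicial rfl

/-- `dstar` is the metric on `X*` associated with the piecewise Euclidean metric `d` on `X`:
the two have the same angle sums at the interior vertices of `X`; the five triangles at the centre
of a pentagon have the angle `2π/5` at the centre, the angles `3π/10` at the other two vertices and
outer side of length `1`; the triangles of `X` are equilateral. -/
structure IsStarMetric (X : TrianglePentagonComplex V) (d : X.EuclideanStructure)
    (dstar : X.star.EuclideanStructure) : Prop where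
  angleSum_eq : ∀ w : V, X.IsInterior w → dstar.angleSum (Sum.inl w) = d.angleSum w
  wheel : ∀ (p : X.pentagons) (a b : V), a ∈ p.1 → b ∈ p.1 → X.graph.Adj a b →
    let P : X.StarVertex → EPlane := dstar.pos (X.wheelTriangle p a b)
    EuclideanGeometry.angle (P (Sum.inl a)) (P (Sum.inr p)) (P (Sum.inl b)) = 2 * Real.pi / 5 ∧
    EuclideanGeometry.angle (P (Sum.inr p)) (P (Sum.inl a)) (P (Sum.inl b)) = 3 * Real.pi / 10 ∧
    EuclideanGeometry.angle (P (Sum.inr p)) (P (Sum.inl b)) (P (Sum.inl a)) = 3 * Real.pi / 10 ∧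
    dist (P (Sum.inl a)) (P (Sum.inl b)) = 1
  equilateral : ∀ t ∈ X.triangles, ∀ a ∈ t, ∀ b ∈ t, ∀ c ∈ t, a ≠ b → a ≠ c →
    let P : X.StarVertex → EPlane := dstar.pos (X.oldTriangle t)
    dist (P (Sum.inl a)) (P (Sum.inl b)) = dist (P (Sum.inl a)) (P (Sum.inl c))

end TrianglePentagonComplex

/-! Two estimates of the angle sum at `v` contradict each other if the link in the subdivision has
at most six edges.

Upper estimate (`exists_angleSum_star_le`). At most six triangles of the subdivision meet at `v`.
Each has angle at most `π/3` there, and since `v` lies on a pentagon at least one has the smaller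
angle `3π/10`. So the angle sum in `dstar` is less than `2π`, and it equals the angle sum in `d`.

Lower estimate (`two_pi_le_total`). Only finitely many 2-cells of `X` contain `v`, so following a
closing family around the interior vertex `v` produces a cycle of distinct cells
(`IsInterior.exists_cycle`). Its total angle `θ` is at most the angle sum, and CAT(0) forces `θ ≥
2π`. Indeed, suppose `θ < 2π`. In polar coordinates around `v` along the cycle, join the points of
radius `R` at angles `0` and `θ/2` by the two straight chords, one on each side of `v`. Each chord
subtends the angle `θ/2 < π`, so it misses `v` and is a local geodesic. Local geodesics with common
endpoints are unique in a CAT(0) space (`local_geodesic_unique`), but just after the common start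
the chords run inside different cells.

That chords are local geodesics needs lower bounds for a distance defined as an infimum over strings
of points. These come from functions that are 1-Lipschitz on every cell and compatible with the
gluing (`abs_sub_le_dist_of_local`): a linear coordinate inside a cell, and near an edge a linear
function on a half plane to which all cells at that edge are folded (`exists_foldedHeight_sub_le`).
-/

/-! ### Comparison triangles and uniqueness of local geodesics in CAT(0) spaces -/

theorem exists_comparison_triangle {a b c : ℝ} (ha : 0 ≤ a) (hb : 0 ≤ b) (hc : 0 ≤ c)
    (h₁ : a ≤ b + c) (h₂ : b ≤ a + c) (h₃ : c ≤ a + b) :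
    ∃ p q r : EPlane, dist p q = a ∧ dist p r = b ∧ dist q r = c := by
  rcases ha.eq_or_lt with rfl | ha
  · obtain rfl : b = c := by linarith
    refine ⟨!₂[0, 0], !₂[0, 0], !₂[b, 0], ?_⟩
    simp [EuclideanSpace.dist_eq, Real.sqrt_sq_eq_abs, abs_of_nonneg hb, Real.dist_eq]
  -- The abscissa of the third vertex by the law of cosines, with the side `a` on the first axis;
  -- the triangle inequalities amount to `|x| ≤ b`.
  set x : ℝ := (a ^ 2 + b ^ 2 - c ^ 2) / (2 * a) with hx
  have hxa : 2 * a * x = a ^ 2 + b ^ 2 - c ^ 2 := by rw [hx]; field_simp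
  have hx₁ : x ≤ b := by
    refine le_of_mul_le_mul_left (a := 2 * a) ?_ (by positivity)
    nlinarith
  have hx₂ : -b ≤ x := by
    refine le_of_mul_le_mul_left (a := 2 * a) ?_ (by positivity)
    nlinarith
  have hy : 0 ≤ b ^ 2 - x ^ 2 := by nlinarith
  have hs := Real.sq_sqrt hy
  refine ⟨!₂[0, 0], !₂[a, 0], !₂[x, √(b ^ 2 - x ^ 2)], ?_, ?_, ?_⟩
  · simp [EuclideanSpace.dist_eq, Real.dist_eq, Real.sqrt_sq_eq_abs, abs_of_pos ha]
  · simp only [EuclideanSpace.dist_eq, Real.dist_eq, Fin.sum_univ_two, sq_abs]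
    refine (congrArg Real.sqrt (?_ : _ = b ^ 2)).trans (Real.sqrt_sq hb)
    simp
    nlinarith
  · simp only [EuclideanSpace.dist_eq, Real.dist_eq, Fin.sum_univ_two, sq_abs]
    refine (congrArg Real.sqrt (?_ : _ = c ^ 2)).trans (Real.sqrt_sq hc)
    simp
    nlinarith

namespace IsGeodesic

variable {M : Type*} [MetricSpace M]

theorem symm {x y : M} {γ : ℝ → M} (h : IsGeodesic x y γ) :
    IsGeodesic y x fun t => γ (1 - t) := by
  refine ⟨by simpa using h.2.1, by simpa using h.1, fun s hs t ht => ?_⟩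
  rw [h.2.2 (1 - s) ⟨by linarith [hs.2], by linarith [hs.1]⟩ (1 - t)
    ⟨by linarith [ht.2], by linarith [ht.1]⟩, dist_comm x y,
    show 1 - s - (1 - t) = -(s - t) by ring, abs_neg]

/-- The affine reparametrization of a unit speed geodesic. -/
theorem of_unit_speed {γ : ℝ → M} {a b : ℝ} (hab : a ≤ b)
    (h : ∀ s ∈ Set.Icc a b, ∀ t ∈ Set.Icc a b, dist (γ s) (γ t) = |s - t|) :
    IsGeodesic (γ a) (γ b) fun t => γ (a + (b - a) * t) := by
  refine ⟨by simp, by simp, fun s hs t ht => ?_⟩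
  have hm : ∀ u ∈ Set.Icc (0 : ℝ) 1, a + (b - a) * u ∈ Set.Icc a b := fun u hu =>
    ⟨by nlinarith [hu.1], by nlinarith [hu.2]⟩
  rw [h _ (hm s hs) _ (hm t ht), h a ⟨le_rfl, hab⟩ b ⟨hab, le_rfl⟩, ← abs_mul]
  rw [show a + (b - a) * s - (a + (b - a) * t) = -((s - t) * (a - b)) by ring, abs_neg]

end IsGeodesic

namespace IsCAT0

variable {M : Type*} [MetricSpace M]

theorem dist_midpoint_le (hM : IsCAT0 M) {p q r : M} {α β : ℝ → M}
    (hα : IsGeodesic p q α) (hβ : IsGeodesic p r β) :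
    dist (α (1 / 2)) (β (1 / 2)) ≤ dist q r / 2 := by
  obtain ⟨p', q', r', h₁, h₂, h₃⟩ := exists_comparison_triangle (a := dist p q) (b := dist p r)
    (c := dist q r) dist_nonneg dist_nonneg dist_nonneg
    (by rw [dist_comm q r]; exact dist_triangle _ _ _) (dist_triangle _ _ _)
    (by rw [dist_comm p q]; exact dist_triangle _ _ _)
  have hmem : (1 / 2 : ℝ) ∈ Set.Icc (0 : ℝ) 1 := by norm_num
  refine (hM.comparison p q r α β hα hβ p' q' r' h₁ h₂ h₃ _ hmem _ hmem).trans_eq ?_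
  rw [← h₃, dist_eq_norm, dist_eq_norm, AffineMap.lineMap_apply, AffineMap.lineMap_apply]
  have : ((1 / 2 : ℝ) • (q' -ᵥ p') +ᵥ p') - ((1 / 2 : ℝ) • (r' -ᵥ p') +ᵥ p')
      = (1 / 2 : ℝ) • (q' - r') := by
    simp only [vsub_eq_sub, vadd_eq_add]
    module
  rw [this, norm_smul]
  norm_num
  ring

/-- Cut the quadrilateral along a geodesic from `p` to `q'` and apply the triangle case on both
sides of this diagonal. -/
theorem dist_midpoint_le_midpoint (hM : IsCAT0 M) {p q p' q' : M} {α β : ℝ → M}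
    (hα : IsGeodesic p q α) (hβ : IsGeodesic p' q' β) :
    dist (α (1 / 2)) (β (1 / 2)) ≤ (dist p p' + dist q q') / 2 := by
  obtain ⟨γ, hγ⟩ := hM.exists_geodesic p q'
  have h₁ := hM.dist_midpoint_le hα hγ
  have h₂ := hM.dist_midpoint_le hγ.symm hβ.symm
  norm_num at h₁ h₂ ⊢
  linarith [dist_triangle (α (1 / 2)) (γ (1 / 2)) (β (1 / 2))]

/-- In a CAT(0) space, local geodesics with common endpoints coincide. -/
theorem local_geodesic_unique (hM : IsCAT0 M) {α β : ℝ → M} {a b : ℝ}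
    (hα : ContinuousOn α (Set.Icc a b)) (hβ : ContinuousOn β (Set.Icc a b))
    (hα' : ∀ y ∈ Set.Ioo a b, ∃ δ > 0, ∀ s ∈ Set.Icc (y - δ) (y + δ),
      ∀ t ∈ Set.Icc (y - δ) (y + δ), dist (α s) (α t) = |s - t|)
    (hβ' : ∀ y ∈ Set.Ioo a b, ∃ δ > 0, ∀ s ∈ Set.Icc (y - δ) (y + δ),
      ∀ t ∈ Set.Icc (y - δ) (y + δ), dist (β s) (β t) = |s - t|)
    (ha : α a = β a) (hb : α b = β b) {y : ℝ} (hy : y ∈ Set.Icc a b) : α y = β y := by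
  by_contra hne
  set f : ℝ → ℝ := fun y => dist (α y) (β y) with hf
  have hfc : ContinuousOn f (Set.Icc a b) := continuous_dist.comp_continuousOn (hα.prodMk hβ)
  obtain ⟨m, hm, hmax⟩ := isCompact_Icc.exists_isMaxOn ⟨y, hy⟩ hfc
  have hpos : 0 < f m := (dist_pos.2 hne).trans_le (hmax hy)
  have hT : IsCompact (Set.Icc a b ∩ f ⁻¹' {f m}) :=
    isCompact_Icc.of_isClosed_subset
      (hfc.preimage_isClosed_of_isClosed isClosed_Icc isClosed_singleton) Set.inter_subset_left
  -- `z` is the first point where the distance of the curves is maximal. Midpoint convexity on `[z -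
  -- η, z + η]` bounds `f z` by the mean of `f (z - η)`, which is smaller than the maximum, and `f
  -- (z + η)`, which is at most the maximum.
  obtain ⟨z, ⟨hz, hzm⟩, hleast⟩ := hT.exists_isLeast ⟨m, hm, rfl⟩
  have hzm : f z = f m := hzm
  have hza : z ≠ a := by
    rintro rfl
    rw [← hzm] at hpos
    simp [hf, ha] at hpos
  have hzb : z ≠ b := by
    rintro rfl
    rw [← hzm] at hpos
    simp [hf, hb] at hpos
  have hzI : z ∈ Set.Ioo a b := ⟨lt_of_le_of_ne hz.1 hza.symm, lt_of_le_of_ne hz.2 hzb⟩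
  obtain ⟨δ, hδ, hαδ⟩ := hα' z hzI
  obtain ⟨δ', hδ', hβδ⟩ := hβ' z hzI
  obtain ⟨η, hη, hη₁, hη₂, hη₃, hη₄⟩ :
      ∃ η > 0, η ≤ δ ∧ η ≤ δ' ∧ η ≤ z - a ∧ η ≤ b - z := by
    refine ⟨min (min δ δ') (min (z - a) (b - z)), ?_, ?_, ?_, ?_, ?_⟩
    · exact lt_min (lt_min hδ hδ') (lt_min (by linarith [hzI.1]) (by linarith [hzI.2]))
    all_goals simp
  have hg : ∀ {γ : ℝ → M} {ε : ℝ}, η ≤ ε → (∀ s ∈ Set.Icc (z - ε) (z + ε),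
      ∀ t ∈ Set.Icc (z - ε) (z + ε), dist (γ s) (γ t) = |s - t|) →
      IsGeodesic (γ (z - η)) (γ (z + η)) fun t => γ (z - η + (z + η - (z - η)) * t) := by
    intro γ ε hε h
    refine IsGeodesic.of_unit_speed (by linarith) fun s hs t ht => h s ?_ t ?_
    · exact ⟨by linarith [hs.1], by linarith [hs.2]⟩
    · exact ⟨by linarith [ht.1], by linarith [ht.2]⟩
  have hmid := hM.dist_midpoint_le_midpoint (hg hη₁ hαδ) (hg hη₂ hβδ)
  simp only [show z - η + (z + η - (z - η)) * (1 / 2) = z by ring] at hmid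
  have h₁ : f (z - η) < f m := by
    refine lt_of_le_of_ne (hmax ⟨by linarith, by linarith [hz.2]⟩) fun h => ?_
    have := hleast ⟨⟨by linarith, by linarith [hz.2]⟩, h⟩
    linarith
  have h₂ : f (z + η) ≤ f m := hmax ⟨by linarith [hz.1], by linarith⟩
  simp only [hf] at h₁ h₂ hzm
  linarith

end IsCAT0

/-! ### Upper and lower bounds for the intrinsic distance -/

theorem edist_le_edist_iff_dist_le_dist {M N : Type*} [PseudoMetricSpace M] [PseudoMetricSpace N]
    {x y : M} {z w : N} : edist x y ≤ edist z w ↔ dist x y ≤ dist z w := by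
  rw [edist_dist, edist_dist, ENNReal.ofReal_le_ofReal_iff dist_nonneg]

namespace PolygonComplex.EuclideanStructure

variable {V : Type*} {K : PolygonComplex V} (E : K.EuclideanStructure)

/-- `P` is the point of the realization given by the point `y` of the cell `c`. -/
def IsPoint (c : Finset V) (y : EPlane) (P : E.Realization) : Prop :=
  ∃ (hc : c ∈ K.cells) (hy : y ∈ E.carrier c), E.toPoint ⟨c, hc⟩ ⟨y, hy⟩ = P

variable {E}

theorem IsPoint.dist_le [MetricSpace E.Realization]
    (hd : ∀ P Q : E.Realization, edist P Q = E.intrinsicEDist P Q)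
    {c : Finset V} {y z : EPlane} {P Q : E.Realization} (hy : E.IsPoint c y P)
    (hz : E.IsPoint c z Q) : dist P Q ≤ dist y z := by
  obtain ⟨hc, hy, rfl⟩ := hy
  obtain ⟨_, hz, rfl⟩ := hz
  set P := E.toPoint ⟨c, hc⟩ ⟨y, hy⟩
  set Q := E.toPoint ⟨c, hc⟩ ⟨z, hz⟩
  rw [← edist_le_edist_iff_dist_le_dist, hd]
  refine (iInf_le_of_le 1 <| iInf_le_of_le (fun i => if i = 0 then P else Q) <|
    iInf_le_of_le (by simp) <| iInf_le_of_le (by simp) ?_)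
  simp only [Finset.range_one, Finset.sum_singleton, zero_add, one_ne_zero, if_true, if_false]
  exact iInf_le_of_le ⟨c, hc⟩ <| iInf_le_of_le ⟨y, hy⟩ <| iInf_le_of_le ⟨z, hz⟩ <|
    iInf_le_of_le rfl <| iInf_le_of_le rfl le_rfl

/-- Sum the Lipschitz estimates along a string. All lower bounds for distances are obtained from
such test functions. -/
theorem abs_sub_le_dist [MetricSpace E.Realization]
    (hd : ∀ P Q : E.Realization, edist P Q = E.intrinsicEDist P Q) {g : E.Realization → ℝ}
    (hg : ∀ (c : K.cells) (x y : E.carrier c),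
      |g (E.toPoint c x) - g (E.toPoint c y)| ≤ dist (x : EPlane) y) (P Q : E.Realization) :
    |g P - g Q| ≤ dist P Q := by
  rw [← Real.dist_eq, ← edist_le_edist_iff_dist_le_dist, hd]
  refine le_iInf fun n => le_iInf fun u => le_iInf fun h₀ => le_iInf fun hn => ?_
  subst h₀ hn
  refine (edist_le_range_sum_edist (fun i => g (u i)) n).trans (Finset.sum_le_sum fun i _ => ?_)
  refine le_iInf fun c => le_iInf fun x => le_iInf fun y => le_iInf fun hx => le_iInf fun hy => ?_
  rw [← hx, ← hy, edist_le_edist_iff_dist_le_dist, Real.dist_eq]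
  exact hg c x y

theorem Glued.symm {x y : E.PrePoint} (h : E.Glued x y) : E.Glued y x := by
  obtain ⟨a, b, hab, h₁, h₂, h₃, h₄, t, ht, h₅, h₆⟩ := h
  exact ⟨a, b, hab, h₃, h₄, h₁, h₂, t, ht, h₆, h₅⟩

/-- Clipping a value to `[-τ, τ]` with `τ = max 0 s` does not increase Lipschitz constants. It is
used to cut off test functions away from a point. -/
theorem abs_clip_sub_le {a b s t δ : ℝ} (h₁ : |a - b| ≤ δ) (h₂ : |s - t| ≤ δ) :
    |max (min a (max 0 s)) (-(max 0 s)) - max (min b (max 0 t)) (-(max 0 t))| ≤ δ := by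
  have h₃ : |max 0 s - max 0 t| ≤ δ := by
    refine (abs_max_sub_max_le_max 0 s 0 t).trans ?_
    simpa using h₂
  refine (abs_max_sub_max_le_max _ _ _ _).trans (max_le ?_ ?_)
  · exact (abs_min_sub_min_le_max _ _ _ _).trans (max_le h₁ h₃)
  · rwa [neg_sub_neg, abs_sub_comm]

/-- Functions that are `1`-Lipschitz on the cells and compatible with the gluing near a point
bound the distance from below. -/
theorem abs_sub_le_dist_of_local [MetricSpace E.Realization]
    (hd : ∀ P Q : E.Realization, edist P Q = E.intrinsicEDist P Q) (S : Set (Finset V))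
    (x₀ : Finset V → EPlane) (G : Finset V → EPlane → ℝ) {ε : ℝ}
    (hG : ∀ c ∈ S, ∀ y z, |G c y - G c z| ≤ dist y z) (hG₀ : ∀ c ∈ S, G c (x₀ c) = 0)
    (hglue : ∀ x y : E.PrePoint, E.Glued x y → x.1.1 ∈ S → dist (x.2 : EPlane) (x₀ x.1) < ε →
      y.1.1 ∈ S ∧ dist (y.2 : EPlane) (x₀ y.1) = dist (x.2 : EPlane) (x₀ x.1) ∧
        G y.1 y.2 = G x.1 x.2)
    {c c' : Finset V} (hc : c ∈ S) (hc' : c' ∈ S) {y y' : EPlane} {P P' : E.Realization}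
    (hP : E.IsPoint c y P) (hP' : E.IsPoint c' y' P') (hy : dist y (x₀ c) ≤ ε / 2)
    (hy' : dist y' (x₀ c') ≤ ε / 2) : |G c y - G c' y'| ≤ dist P P' := by
  classical
  -- Clipping `G` to `[-τ, τ]` makes it vanish at distance `ε` from `x₀`, so it extends by zero to
  -- the other cells. Within `ε / 2` nothing is clipped, because there `|G| ≤ dist y (x₀ c) ≤ τ`.
  set τ : E.PrePoint → ℝ := fun q => max 0 (ε - dist (q.2 : EPlane) (x₀ q.1)) with hτ
  set g₀ : E.PrePoint → ℝ := fun q =>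
    if q.1.1 ∈ S then max (min (G q.1 q.2) (τ q)) (-(τ q)) else 0 with hg₀
  have hfar : ∀ q : E.PrePoint, (q.1.1 ∈ S → ε ≤ dist (q.2 : EPlane) (x₀ q.1)) → g₀ q = 0 := by
    intro q hq
    by_cases h : q.1.1 ∈ S
    · have : τ q = 0 := max_eq_left (by linarith [hq h])
      simp only [hg₀, if_pos h, this]
      simp
    · simp only [hg₀, if_neg h]
  have hg : ∀ x y, E.Glued x y → g₀ x = g₀ y := by
    intro x y hxy
    by_cases hx : x.1.1 ∈ S ∧ dist (x.2 : EPlane) (x₀ x.1) < ε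
    · obtain ⟨h₁, h₂, h₃⟩ := hglue x y hxy hx.1 hx.2
      simp only [hg₀, hτ, if_pos hx.1, if_pos h₁, h₂, h₃]
    · have hy : ¬ (y.1.1 ∈ S ∧ dist (y.2 : EPlane) (x₀ y.1) < ε) := fun hy => by
        obtain ⟨h₁, h₂, h₃⟩ := hglue y x hxy.symm hy.1 hy.2
        exact hx ⟨h₁, h₂ ▸ hy.2⟩
      push Not at hx hy
      rw [hfar x hx, hfar y hy]
  set g : E.Realization → ℝ := Quot.lift g₀ hg with hgdef
  have hgl : ∀ (c : K.cells) (x y : E.carrier c),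
      |g (E.toPoint c x) - g (E.toPoint c y)| ≤ dist (x : EPlane) y := by
    intro c x y
    change |g₀ ⟨c, x⟩ - g₀ ⟨c, y⟩| ≤ _
    by_cases h : c.1 ∈ S
    · simp only [hg₀, hτ, if_pos h]
      refine abs_clip_sub_le (hG _ h _ _) ?_
      rw [sub_sub_sub_cancel_left, abs_sub_comm]
      exact abs_dist_sub_le _ _ _
    · simp [hg₀, if_neg h]
  have hgG : ∀ {c y P}, c ∈ S → E.IsPoint c y P → dist y (x₀ c) ≤ ε / 2 → g P = G c y := by
    rintro c y _ hc ⟨h₁, h₂, rfl⟩ hy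
    change g₀ ⟨⟨c, h₁⟩, ⟨y, h₂⟩⟩ = _
    have h₃ := hG c hc y (x₀ c)
    rw [hG₀ c hc, sub_zero, abs_le] at h₃
    have h₄ : ε - dist y (x₀ c) ≤ max 0 (ε - dist y (x₀ c)) := le_max_right _ _
    simp only [hg₀, hτ, if_pos hc]
    rw [min_eq_left (by linarith), max_eq_left (by linarith)]
  rw [← hgG hc hP hy, ← hgG hc' hP' hy']
  exact abs_sub_le_dist hd hgl P P'

/-- `x` does not lie on the boundary of the cell `c`. -/
def OffBoundary (E : K.EuclideanStructure) (c : Finset V) (x : EPlane) : Prop :=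
  ∀ a ∈ c, ∀ b ∈ c, (a = b ∨ K.graph.Adj a b) → ∀ t ∈ Set.Icc (0 : ℝ) 1,
    (AffineMap.lineMap (E.pos c a) (E.pos c b) t : EPlane) ≠ x

theorem IsPoint.cell_eq {c c' : Finset V} {x x' : EPlane} {P : E.Realization}
    (h : E.IsPoint c x P) (h' : E.IsPoint c' x' P) (hx : E.OffBoundary c x) : c' = c := by
  obtain ⟨hc, hy, rfl⟩ := h
  obtain ⟨hc', hy', heq⟩ := h'
  have key : ∀ p q : E.PrePoint, E.Glued p q → p ≠ ⟨⟨c, hc⟩, ⟨x, hy⟩⟩ := by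
    rintro p q ⟨a, b, hab, h₁, h₂, -, -, t, ht, h₅, -⟩ rfl
    exact hx a h₁ b h₂ hab t ht h₅.symm
  -- A point off the boundary is glued to nothing, so the predicate of being this point descends to
  -- the quotient.
  have h := congrArg (Quot.lift (fun p : E.PrePoint => p = ⟨⟨c, hc⟩, ⟨x, hy⟩⟩)
    fun p q hpq => by simp [key p q hpq, key q p hpq.symm]) heq
  have h₁ : (⟨⟨c', hc'⟩, ⟨x', hy'⟩⟩ : E.PrePoint) = ⟨⟨c, hc⟩, ⟨x, hy⟩⟩ := by
    exact h.mpr rfl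
  exact congrArg (fun q : E.PrePoint => q.1.1) h₁

/-- Compactness of the segment. The statement is about all small `ε`, so that finitely many segments
can be treated simultaneously. -/
theorem eventually_le_dist_segment {p q x : EPlane}
    (h : ∀ t ∈ Set.Icc (0 : ℝ) 1, (AffineMap.lineMap p q t : EPlane) ≠ x) :
    ∀ᶠ ε in nhdsWithin (0 : ℝ) (Set.Ioi 0), ∀ t ∈ Set.Icc (0 : ℝ) 1,
      ε ≤ dist (AffineMap.lineMap p q t : EPlane) x := by
  have hcont : ContinuousOn (fun t : ℝ => dist (AffineMap.lineMap p q t : EPlane) x)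
      (Set.Icc 0 1) :=
    ((AffineMap.lineMap_continuous (R := ℝ) (p := p) (q := q)).dist continuous_const).continuousOn
  obtain ⟨s, hs, hmin⟩ := isCompact_Icc.exists_isMinOn ⟨0, by simp⟩ hcont
  have hpos := dist_pos.2 (h s hs)
  filter_upwards [Ioo_mem_nhdsGT hpos] with ε hε t ht
  exact hε.2.le.trans (hmin ht)

/-- The relation `r` selects the sides concerned: all of them for points inside a cell, all but one
for points inside an edge. -/
theorem eventually_le_dist_boundary {c : Finset V} {x : EPlane} {r : V → V → Prop}
    (h : ∀ a ∈ c, ∀ b ∈ c, r a b → ∀ t ∈ Set.Icc (0 : ℝ) 1,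
      (AffineMap.lineMap (E.pos c a) (E.pos c b) t : EPlane) ≠ x) :
    ∀ᶠ ε in nhdsWithin (0 : ℝ) (Set.Ioi 0), ∀ a ∈ c, ∀ b ∈ c, r a b →
      ∀ t ∈ Set.Icc (0 : ℝ) 1,
        ε ≤ dist (AffineMap.lineMap (E.pos c a) (E.pos c b) t : EPlane) x := by
  refine (Filter.eventually_all_finset c).2 fun a ha =>
    (Filter.eventually_all_finset c).2 fun b hb => ?_
  by_cases hab : r a b
  · filter_upwards [eventually_le_dist_segment (h a ha b hb hab)] with ε hε _
    exact hε
  · exact Filter.Eventually.of_forall fun _ h => absurd h hab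

/-- The realization is locally isometric to the plane in the interior of a cell. -/
theorem OffBoundary.exists_dist_le [MetricSpace E.Realization]
    (hd : ∀ P Q : E.Realization, edist P Q = E.intrinsicEDist P Q) {c : Finset V} {x : EPlane}
    (hx : E.OffBoundary c x) : ∃ ε > 0, ∀ y y' P P', E.IsPoint c y P → E.IsPoint c y' P' →
      dist y x ≤ ε → dist y' x ≤ ε → dist y y' ≤ dist P P' := by
  obtain ⟨ε, hε, hpos⟩ := ((eventually_le_dist_boundary hx).and self_mem_nhdsWithin).exists
  refine ⟨ε / 2, half_pos hpos, fun y y' P P' hy hy' h h' => ?_⟩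
  rcases eq_or_ne y y' with rfl | hne
  · simp
  have hn : ‖y - y'‖ ≠ 0 := norm_ne_zero_iff.2 (sub_ne_zero.2 hne)
  -- The coordinate in the direction from `y'` to `y` is 1-Lipschitz and realizes the distance of
  -- the two points. Its compatibility with the gluing is vacuous, as no boundary point is closer
  -- than `ε` to `x`.
  set u : EPlane := ‖y - y'‖⁻¹ • (y - y') with hu
  have hu₁ : ‖u‖ = 1 := by rw [hu, norm_smul, norm_inv, norm_norm, inv_mul_cancel₀ hn]
  have key := abs_sub_le_dist_of_local hd {c} (fun _ => x) (fun _ z => inner ℝ u (z - x))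
    (ε := ε) ?_ ?_ ?_ rfl rfl hy hy' h h'
  · rw [← inner_sub_right, sub_sub_sub_cancel_right, hu, real_inner_smul_left,
      real_inner_self_eq_norm_sq, pow_two, inv_mul_cancel_left₀ hn, abs_norm] at key
    rwa [dist_eq_norm]
  · rintro _ - y z
    rw [← inner_sub_right, sub_sub_sub_cancel_right, dist_eq_norm]
    simpa [hu₁] using abs_real_inner_le_norm u (y - z)
  · simp
  · rintro ⟨⟨c₁, _⟩, z⟩ q ⟨a, b, hab, h₁, h₂, -, -, t, ht, h₅, -⟩ (rfl : c₁ = c) hlt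
    exact absurd hlt (not_lt.2 (h₅ ▸ hε a h₁ b h₂ hab t ht))

end PolygonComplex.EuclideanStructure

/-! ### Folding the plane along a line -/

/-- A linear function of the coordinates of `p` in direction `e` and of the distance of `p` from
the line spanned by `e`. -/
noncomputable def foldedHeight (e : EPlane) (A B : ℝ) (p : EPlane) : ℝ :=
  A * inner ℝ e p + B * ‖p - (inner ℝ e p : ℝ) • e‖

theorem norm_sub_inner_smul_sq {e : EPlane} (he : ‖e‖ = 1) (p : EPlane) :
    ‖p - (inner ℝ e p : ℝ) • e‖ ^ 2 = ‖p‖ ^ 2 - (inner ℝ e p : ℝ) ^ 2 := by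
  rw [norm_sub_sq_real, norm_smul, real_inner_smul_right, he, real_inner_comm, Real.norm_eq_abs,
    mul_one, sq_abs]
  ring

theorem foldedHeight_eq {e p : EPlane} (he : ‖e‖ = 1) {A B ξ η : ℝ} (h₁ : inner ℝ e p = ξ)
    (h₂ : ‖p‖ ^ 2 = ξ ^ 2 + η ^ 2) (hη : 0 ≤ η) : foldedHeight e A B p = A * ξ + B * η := by
  have h := norm_sub_inner_smul_sq he p
  rw [h₁, h₂, add_sub_cancel_left, sq_eq_sq₀ (norm_nonneg _) hη] at h
  rw [foldedHeight, h₁, h]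

/-- Folding the plane onto a half plane does not increase distances, and `(A, B)` is a unit vector,
so Cauchy–Schwarz applies. -/
theorem abs_foldedHeight_sub_le {e : EPlane} (he : ‖e‖ = 1) {A B : ℝ} (hAB : A ^ 2 + B ^ 2 = 1)
    (p q : EPlane) : |foldedHeight e A B p - foldedHeight e A B q| ≤ ‖p - q‖ := by
  have h := norm_sub_inner_smul_sq he (p - q)
  have h₁ : |‖p - (inner ℝ e p : ℝ) • e‖ - ‖q - (inner ℝ e q : ℝ) • e‖|
      ≤ ‖(p - q) - (inner ℝ e (p - q) : ℝ) • e‖ := by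
    refine (abs_norm_sub_norm_le _ _).trans_eq (congrArg _ ?_)
    rw [inner_sub_right]
    module
  have h₂ : (‖p - (inner ℝ e p : ℝ) • e‖ - ‖q - (inner ℝ e q : ℝ) • e‖) ^ 2
      ≤ ‖p - q‖ ^ 2 - (inner ℝ e (p - q) : ℝ) ^ 2 := by
    rw [← h, ← sq_abs]
    exact pow_le_pow_left₀ (abs_nonneg _) h₁ 2
  set w := ‖p - (inner ℝ e p : ℝ) • e‖ - ‖q - (inner ℝ e q : ℝ) • e‖
  set u : ℝ := inner ℝ e (p - q) with hu
  have h₃ : foldedHeight e A B p - foldedHeight e A B q = A * u + B * w := by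
    simp only [foldedHeight, w, hu, inner_sub_right]
    ring
  rw [h₃]
  refine abs_le_of_sq_le_sq ?_ (norm_nonneg _)
  have h₄ : (A * u + B * w) ^ 2 + (A * w - B * u) ^ 2 = u ^ 2 + w ^ 2 := by
    linear_combination (u ^ 2 + w ^ 2) * hAB
  nlinarith [sq_nonneg (A * w - B * u)]

/-! ### Circular sectors -/

/-- The point with polar coordinates `(r, φ)` in the sector spanned by `A` and `B`. -/
noncomputable def sectorPoint (A B : EPlane) (r φ : ℝ) : EPlane :=
  (r * (Real.sin (InnerProductGeometry.angle A B - φ) /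
      Real.sin (InnerProductGeometry.angle A B))) • (‖A‖⁻¹ • A) +
    (r * (Real.sin φ / Real.sin (InnerProductGeometry.angle A B))) • (‖B‖⁻¹ • B)

/-- The coefficients in `sectorPoint` are those of the law of sines. The identity holds for all
angles, not only those inside the sector, so no case distinctions arise later. -/
theorem inner_sectorPoint {A B : EPlane} (h : Real.sin (InnerProductGeometry.angle A B) ≠ 0)
    (hA : A ≠ 0) (hB : B ≠ 0) (r φ r' φ' : ℝ) :
    inner ℝ (sectorPoint A B r φ) (sectorPoint A B r' φ') = r * r' * Real.cos (φ - φ') := by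
  have hA₁ : ‖(‖A‖⁻¹ • A)‖ = 1 := by
    rw [norm_smul, norm_inv, norm_norm, inv_mul_cancel₀ (norm_ne_zero_iff.2 hA)]
  have hB₁ : ‖(‖B‖⁻¹ • B)‖ = 1 := by
    rw [norm_smul, norm_inv, norm_norm, inv_mul_cancel₀ (norm_ne_zero_iff.2 hB)]
  have hAB : inner ℝ (‖A‖⁻¹ • A) (‖B‖⁻¹ • B) = Real.cos (InnerProductGeometry.angle A B) := by
    rw [InnerProductGeometry.cos_angle, real_inner_smul_left, real_inner_smul_right]
    field_simp
  have hBA := (real_inner_comm _ _).trans hAB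
  unfold sectorPoint
  set γ := InnerProductGeometry.angle A B
  simp only [inner_add_left, inner_add_right, real_inner_smul_left (‖A‖⁻¹ • A),
    real_inner_smul_left (‖B‖⁻¹ • B), real_inner_smul_right _ (‖A‖⁻¹ • A),
    real_inner_smul_right _ (‖B‖⁻¹ • B), hAB, hBA, real_inner_self_eq_norm_sq, hA₁, hB₁]
  have hs := Real.sin_sq_add_cos_sq γ
  field_simp
  rw [Real.sin_sub, Real.sin_sub, Real.cos_sub]
  have hs' : Real.cos γ ^ 2 = 1 - Real.sin γ ^ 2 := by linarith
  ring_nf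
  simp only [hs']
  ring

theorem sectorPoint_zero_angle {A B : EPlane} (h : Real.sin (InnerProductGeometry.angle A B) ≠ 0)
    (r : ℝ) : sectorPoint A B r 0 = r • (‖A‖⁻¹ • A) := by
  simp [sectorPoint, div_self h]

theorem sectorPoint_angle {A B : EPlane} (h : Real.sin (InnerProductGeometry.angle A B) ≠ 0)
    (r : ℝ) : sectorPoint A B r (InnerProductGeometry.angle A B) = r • (‖B‖⁻¹ • B) := by
  simp [sectorPoint, div_self h]

/-! ### Cells -/

theorem SimpleGraph.cycleGraph_five_neighbors (i : Fin 5) :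
    ∃ j k : Fin 5, j ≠ k ∧ (cycleGraph 5).Adj i j ∧ (cycleGraph 5).Adj i k ∧
      ∀ l, (cycleGraph 5).Adj i l → l = j ∨ l = k := by
  refine ⟨i + 1, i - 1, ?_⟩
  revert i
  decide

namespace PolygonComplex

variable {V : Type*} {K : PolygonComplex V}

theorem twoCells_subset_cells : K.twoCells ⊆ K.cells := by
  rintro c (h | h)
  · exact Or.inr (Or.inr (Or.inl h))
  · exact Or.inr (Or.inr (Or.inr h))

theorem exists_two_neighbors {c : Finset V} (hc : c ∈ K.twoCells) {v : V} (hv : v ∈ c) :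
    ∃ a b, a ≠ b ∧ a ∈ c ∧ b ∈ c ∧ K.graph.Adj v a ∧ K.graph.Adj v b ∧
      ∀ w ∈ c, K.graph.Adj v w → w = a ∨ w = b := by
  classical
  rcases hc with hc | hc
  · have h := K.triangles_isClique c hc
    have h₂ : (c.erase v).card = 2 := by rw [Finset.card_erase_of_mem hv, h.card_eq]
    obtain ⟨a, b, hab, he⟩ := Finset.card_eq_two.1 h₂
    have ha : a ∈ c.erase v := by simp [he]
    have hb : b ∈ c.erase v := by simp [he]
    rw [Finset.mem_erase] at ha hb
    refine ⟨a, b, hab, ha.2, hb.2, h.isClique hv ha.2 ha.1.symm, h.isClique hv hb.2 hb.1.symm, ?_⟩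
    intro w hw hvw
    have : w ∈ c.erase v := Finset.mem_erase.2 ⟨hvw.ne', hw⟩
    simpa [he] using this
  · obtain ⟨f, rfl⟩ := K.pentagons_induced c hc
    simp only [Finset.mem_map, Finset.mem_univ, true_and] at hv ⊢
    obtain ⟨i, rfl⟩ := hv
    obtain ⟨j, k, hjk, h₁, h₂, h₃⟩ := SimpleGraph.cycleGraph_five_neighbors i
    refine ⟨f j, f k, f.injective.ne hjk, ⟨j, rfl⟩, ⟨k, rfl⟩, f.map_adj_iff.2 h₁,
      f.map_adj_iff.2 h₂, ?_⟩
    rintro _ ⟨l, rfl⟩ hl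
    exact (h₃ l (f.map_adj_iff.1 hl)).imp (congrArg f) (congrArg f)

namespace EuclideanStructure

variable (E : K.EuclideanStructure)

/-- A linear form that is constant on a side of a cell and larger at all other vertices. -/
theorem exists_supporting_form {c : Finset V} (hc : c ∈ K.cells) {a b : V} (ha : a ∈ c)
    (hb : b ∈ c) (hab : K.graph.Adj a b) :
    ∃ f : EPlane →ₗ[ℝ] ℝ, ∃ k : ℝ, f (E.pos c a) = k ∧ f (E.pos c b) = k ∧
      ∀ x ∈ c, x ≠ a → x ≠ b → k < f (E.pos c x) := by
  by_cases hex : ∃ z ∈ c, z ≠ a ∧ z ≠ b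
  swap
  · push Not at hex
    exact ⟨0, 0, rfl, rfl, fun x hx h₁ h₂ => absurd (hex x hx h₁) h₂⟩
  obtain ⟨z, hz, hza, hzb⟩ := hex
  set s : AffineSubspace ℝ EPlane := affineSpan ℝ {E.pos c a, E.pos c b} with hs
  have has : E.pos c a ∈ s := left_mem_affineSpan_pair ℝ _ _
  have hbs : E.pos c b ∈ s := right_mem_affineSpan_pair ℝ _ _
  have hzs : E.pos c z ∉ s :=
    (E.strictConvex c hc a ha b hb hab z hz z hz hza hzb hza hzb).2.1
  have hzd : E.pos c z - E.pos c a ∉ s.direction := fun h => by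
    rw [← vsub_eq_sub, AffineSubspace.vsub_right_mem_direction_iff_mem has] at h
    exact hzs h
  obtain ⟨f, hf, hfd⟩ := Submodule.exists_le_ker_of_notMem hzd
  replace hfd : ∀ x ∈ s.direction, x ∈ f.ker := fun x hx => hfd hx
  -- Scaling `f` by its nonzero value at `z - a` makes the form positive on the side of `z`, hence
  -- at all other vertices.
  refine ⟨f (E.pos c z - E.pos c a) • f, f (E.pos c z - E.pos c a) * f (E.pos c a), by simp, ?_, ?_⟩
  · have := hfd _ (AffineSubspace.vsub_mem_direction hbs has)
    rw [LinearMap.mem_ker, vsub_eq_sub, map_sub, sub_eq_zero] at this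
    simp [this]
  · intro x hx hxa hxb
    obtain ⟨-, hxs, q, hq, hray⟩ := (AffineSubspace.sSameSide_iff_exists_left has).1
      (E.strictConvex c hc a ha b hb hab z hz x hx hza hzb hxa hxb)
    obtain ⟨r₁, r₂, hr₁, hr₂, hr⟩ := hray.exists_pos
      (vsub_ne_zero.2 fun h => hzs (h ▸ has)) (vsub_ne_zero.2 fun h => hxs (h ▸ hq))
    have hqa := hfd _ (AffineSubspace.vsub_mem_direction hq has)
    rw [LinearMap.mem_ker, vsub_eq_sub, map_sub, sub_eq_zero] at hqa
    have h₁ := congrArg f hr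
    simp only [vsub_eq_sub, map_smul, map_sub, smul_eq_mul, hqa] at h₁
    have h₂ : f (E.pos c z - E.pos c a) ^ 2 * r₁
        = r₂ * (f (E.pos c z - E.pos c a) * (f (E.pos c x) - f (E.pos c a))) := by
      simp only [map_sub]
      linear_combination (f (E.pos c z) - f (E.pos c a)) * h₁
    have h₃ : 0 < r₂ * (f (E.pos c z - E.pos c a) * (f (E.pos c x) - f (E.pos c a))) := by
      rw [← h₂]
      positivity
    have h₄ := pos_of_mul_pos_right h₃ hr₂.le
    simp only [LinearMap.smul_apply, smul_eq_mul]
    linarith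

variable {E}

theorem pos_ne {c : Finset V} (hc : c ∈ K.cells) {a b : V} (ha : a ∈ c) (hb : b ∈ c)
    (hab : a ≠ b) : E.pos c a ≠ E.pos c b := fun h => hab (E.injOn c hc ha hb h)

/-- The form supporting the side `va` vanishes on the direction of `a` but not on that of `b`, so
the two directions are not parallel. -/
theorem sin_corner_pos {c : Finset V} (hc : c ∈ K.cells) {v a b : V} (hv : v ∈ c) (ha : a ∈ c)
    (hb : b ∈ c) (hab : a ≠ b) (hva : K.graph.Adj v a) (hvb : K.graph.Adj v b) :
    0 < Real.sin (InnerProductGeometry.angle (E.pos c a - E.pos c v) (E.pos c b - E.pos c v)) := by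
  obtain ⟨f, k, h₁, h₂, h₃⟩ := E.exists_supporting_form hc hv ha hva
  have h₄ := h₃ b hb hvb.ne' hab.symm
  have key : ∀ r : ℝ, E.pos c b - E.pos c v ≠ r • (E.pos c a - E.pos c v) := fun r hr => by
    have := congrArg f hr
    simp only [map_sub, map_smul, h₁, h₂, smul_eq_mul] at this
    linarith
  refine Real.sin_pos_of_pos_of_lt_pi (lt_of_le_of_ne (InnerProductGeometry.angle_nonneg _ _) ?_)
    (lt_of_le_of_ne (InnerProductGeometry.angle_le_pi _ _) ?_)
  · intro h
    obtain ⟨-, r, -, hr⟩ := InnerProductGeometry.angle_eq_zero_iff.1 h.symm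
    exact key r hr
  · intro h
    obtain ⟨-, r, -, hr⟩ := InnerProductGeometry.angle_eq_pi_iff.1 h
    exact key r hr

/-- The point is a convex combination of `v`, `a`, `b` with positive weights. If it lay on a side,
the form supporting that side would be minimal at all three, but it is minimal at the two ends of
the side only. -/
theorem offBoundary_of_corner {c : Finset V} (hc : c ∈ K.twoCells) {v a b : V} (hv : v ∈ c)
    (ha : a ∈ c) (hb : b ∈ c) (hab : a ≠ b) (hva : K.graph.Adj v a) (hvb : K.graph.Adj v b)
    {s t : ℝ} (hs : 0 < s) (ht : 0 < t) (hst : s + t < 1) :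
    E.OffBoundary c (E.pos c v + (s • (E.pos c a - E.pos c v) + t • (E.pos c b - E.pos c v))) := by
  have main : ∀ p ∈ c, ∀ q ∈ c, K.graph.Adj p q → ∀ τ : ℝ,
      (AffineMap.lineMap (E.pos c p) (E.pos c q) τ : EPlane) ≠
        E.pos c v + (s • (E.pos c a - E.pos c v) + t • (E.pos c b - E.pos c v)) := by
    intro p hp q hq hpq τ h
    obtain ⟨f, k, h₁, h₂, h₃⟩ := E.exists_supporting_form (twoCells_subset_cells hc) hp hq hpq
    have hle : ∀ x ∈ c, k ≤ f (E.pos c x) := fun x hx => by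
      by_cases hxp : x = p
      · exact hxp ▸ h₁.ge
      by_cases hxq : x = q
      · exact hxq ▸ h₂.ge
      exact (h₃ x hx hxp hxq).le
    have hf := congrArg f h
    simp only [AffineMap.lineMap_apply, vsub_eq_sub, vadd_eq_add, map_add, map_smul, map_sub,
      smul_eq_mul, h₁, h₂, sub_self, mul_zero, zero_add] at hf
    have h₄ := hle v hv
    have h₅ := hle a ha
    have h₆ := hle b hb
    have hsum : (1 - s - t) * (f (E.pos c v) - k) + s * (f (E.pos c a) - k)
        + t * (f (E.pos c b) - k) = 0 := by linear_combination -hf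
    have h₇ : 0 ≤ (1 - s - t) * (f (E.pos c v) - k) :=
      mul_nonneg (by linarith) (by linarith)
    have h₈ : 0 ≤ s * (f (E.pos c a) - k) := mul_nonneg hs.le (by linarith)
    have h₉ : 0 ≤ t * (f (E.pos c b) - k) := mul_nonneg ht.le (by linarith)
    have hmem : ∀ x ∈ c, f (E.pos c x) - k = 0 → x = p ∨ x = q := fun x hx hxk => by
      by_contra hne
      push Not at hne
      linarith [h₃ x hx hne.1 hne.2]
    have hv' := hmem v hv ((mul_eq_zero.1 (by linarith : (1 - s - t) * (f (E.pos c v) - k) = 0)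
      ).resolve_left (by linarith))
    have ha' := hmem a ha ((mul_eq_zero.1 (by linarith : s * (f (E.pos c a) - k) = 0)
      ).resolve_left hs.ne')
    have hb' := hmem b hb ((mul_eq_zero.1 (by linarith : t * (f (E.pos c b) - k) = 0)
      ).resolve_left ht.ne')
    have hva' := hva.ne
    have hvb' := hvb.ne
    grind
  intro p hp q hq hpq τ _
  rcases hpq with rfl | hpq
  · obtain ⟨q, -, -, hq, -, hpq, -⟩ := exists_two_neighbors hc hp
    have := main p hp q hq hpq 0
    simpa using this
  · exact main p hp q hq hpq τ

/-- The unit vector pointing from `v` to `w` in the cell `c`. -/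
noncomputable def edgeDir (E : K.EuclideanStructure) (c : Finset V) (v w : V) : EPlane :=
  ‖E.pos c w - E.pos c v‖⁻¹ • (E.pos c w - E.pos c v)

theorem norm_edgeDir {c : Finset V} (hc : c ∈ K.cells) {v w : V} (hv : v ∈ c) (hw : w ∈ c)
    (hvw : v ≠ w) : ‖E.edgeDir c v w‖ = 1 := by
  rw [edgeDir, norm_smul, norm_inv, norm_norm, inv_mul_cancel₀]
  exact norm_ne_zero_iff.2 (sub_ne_zero.2 (pos_ne hc hw hv hvw.symm))

theorem smul_edgeDir {c : Finset V} (hc : c ∈ K.cells) {v w : V} (hv : v ∈ c) (hw : w ∈ c)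
    (hvw : v ≠ w) :
    dist (E.pos c v) (E.pos c w) • E.edgeDir c v w = E.pos c w - E.pos c v := by
  rw [edgeDir, dist_comm, dist_eq_norm, smul_inv_smul₀]
  exact norm_ne_zero_iff.2 (sub_ne_zero.2 (pos_ne hc hw hv hvw.symm))

/-- An inner point of the edge `vw` has positive weights at `v` and `w`; on another side, the
supporting form would force both to be ends of that side. -/
theorem lineMap_ne_of_edge {c : Finset V} (hc : c ∈ K.cells) {v w : V} (hv : v ∈ c) (hw : w ∈ c)
    (hvw : K.graph.Adj v w) {s : ℝ} (hs : 0 < s) (hs' : s < 1) {a b : V} (ha : a ∈ c) (hb : b ∈ c)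
    (hab : (a = b ∨ K.graph.Adj a b) ∧ ¬ (a = v ∧ b = w) ∧ ¬ (a = w ∧ b = v)) (t : ℝ) :
    (AffineMap.lineMap (E.pos c a) (E.pos c b) t : EPlane) ≠
      E.pos c v + s • (E.pos c w - E.pos c v) := by
  obtain ⟨rfl | hab, h₁, h₂⟩ := hab
  · rw [AffineMap.lineMap_same_apply]
    intro h
    have hne : E.pos c w - E.pos c v ≠ 0 := sub_ne_zero.2 (pos_ne hc hw hv hvw.ne')
    by_cases hav : a = v
    · subst hav
      simp [hne, hs.ne'] at h
    by_cases haw : a = w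
    · subst haw
      have h₃ : (1 - s) • (E.pos c a - E.pos c v) = 0 := by
        rw [sub_smul, one_smul, sub_eq_zero, sub_eq_iff_eq_add', ← h]
      rcases smul_eq_zero.1 h₃ with h₄ | h₄
      · linarith
      · exact hne h₄
    obtain ⟨f, k, hf₁, hf₂, hf₃⟩ := E.exists_supporting_form hc hv hw hvw
    have h₃ := hf₃ a ha hav haw
    rw [h] at h₃
    simp [hf₁, hf₂] at h₃
  · intro h
    obtain ⟨f, k, hf₁, hf₂, hf₃⟩ := E.exists_supporting_form hc ha hb hab
    have hf := congrArg f h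
    simp only [AffineMap.lineMap_apply, vsub_eq_sub, vadd_eq_add, map_add, map_smul, map_sub,
      smul_eq_mul, hf₁, hf₂, sub_self, mul_zero, zero_add] at hf
    have hle : ∀ x ∈ c, k ≤ f (E.pos c x) := fun x hx => by
      by_cases hxp : x = a
      · exact hxp ▸ hf₁.ge
      by_cases hxq : x = b
      · exact hxq ▸ hf₂.ge
      exact (hf₃ x hx hxp hxq).le
    have h₃ : (1 - s) * (f (E.pos c v) - k) + s * (f (E.pos c w) - k) = 0 := by
      linear_combination -hf
    have h₄ : 0 ≤ (1 - s) * (f (E.pos c v) - k) :=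
      mul_nonneg (by linarith) (by linarith [hle v hv])
    have h₅ : 0 ≤ s * (f (E.pos c w) - k) := mul_nonneg hs.le (by linarith [hle w hw])
    have hmem : ∀ x ∈ c, f (E.pos c x) - k = 0 → x = a ∨ x = b := fun x hx hxk => by
      by_contra hne
      push Not at hne
      linarith [hf₃ x hx hne.1 hne.2]
    have hv' := hmem v hv ((mul_eq_zero.1 (by linarith : (1 - s) * (f (E.pos c v) - k) = 0)
      ).resolve_left (by linarith))
    have hw' := hmem w hw ((mul_eq_zero.1 (by linarith : s * (f (E.pos c w) - k) = 0)
      ).resolve_left hs.ne')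
    have := hvw.ne
    grind

theorem cells_of_edge_subset [DecidableEq V] {v w : V} (hvw : v ≠ w) :
    {c | c ∈ K.cells ∧ v ∈ c ∧ w ∈ c} ⊆
      insert {v, w} {c | c ∈ K.twoCells ∧ v ∈ c} := by
  rintro c ⟨h | h | h, hv, hw⟩
  · obtain ⟨a, rfl⟩ := Finset.card_eq_one.1 h
    simp only [Finset.mem_singleton] at hv hw
    exact absurd (hv.trans hw.symm) hvw
  · left
    refine (Finset.eq_of_subset_of_card_le (by simp [Finset.insert_subset_iff, hv, hw]) ?_).symm
    rw [h.card_eq, Finset.card_pair hvw]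
  · exact Or.inr ⟨h, hv⟩

/-- A lower bound for distances near an inner point of an edge, obtained by folding the cells at
that edge to two half planes. -/
theorem exists_foldedHeight_sub_le [MetricSpace E.Realization]
    (hd : ∀ P Q : E.Realization, edist P Q = E.intrinsicEDist P Q) {v w : V}
    (hvw : K.graph.Adj v w) (hfin : {c | c ∈ K.twoCells ∧ v ∈ c}.Finite) {r : ℝ} (hr : 0 < r)
    {c₀ : Finset V} (hc₀ : c₀ ∈ K.cells) (hv₀ : v ∈ c₀) (hw₀ : w ∈ c₀)
    (hr' : r < dist (E.pos c₀ v) (E.pos c₀ w)) :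
    ∃ ε > 0, ∀ A B : ℝ, A ^ 2 + B ^ 2 = 1 → ∀ σ : Finset V → ℝ, (∀ c, σ c ^ 2 = 1) →
      ∀ c c' y y' P P', v ∈ c → w ∈ c → v ∈ c' → w ∈ c' →
        E.IsPoint c (E.pos c v + y) P → E.IsPoint c' (E.pos c' v + y') P' →
        ‖y - r • E.edgeDir c v w‖ ≤ ε → ‖y' - r • E.edgeDir c' v w‖ ≤ ε →
        |foldedHeight (E.edgeDir c v w) A (σ c * B) y -
          foldedHeight (E.edgeDir c' v w) A (σ c' * B) y'| ≤ dist P P' := by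
  classical
  set l := dist (E.pos c₀ v) (E.pos c₀ w) with hl
  have hl₀ : 0 < l := hr.trans hr'
  set S : Set (Finset V) := {c | c ∈ K.cells ∧ v ∈ c ∧ w ∈ c} with hS
  have hlen : ∀ c ∈ S, l • E.edgeDir c v w = E.pos c w - E.pos c v := fun c hc => by
    rw [hl, ← E.length_eq c hc.1 c₀ hc₀ v w hvw hc.2.1 hc.2.2 hv₀ hw₀]
    exact smul_edgeDir hc.1 hc.2.1 hc.2.2 hvw.ne
  have hnorm : ∀ c ∈ S, ‖E.edgeDir c v w‖ = 1 := fun c hc =>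
    norm_edgeDir hc.1 hc.2.1 hc.2.2 hvw.ne
  have hSfin : S.Finite := (hfin.insert _).subset (cells_of_edge_subset hvw.ne)
  set x₀ : Finset V → EPlane := fun c => E.pos c v + r • E.edgeDir c v w with hx₀
  have hx₀' : ∀ c ∈ S, x₀ c = E.pos c v + (r / l) • (E.pos c w - E.pos c v) := fun c hc => by
    rw [← hlen c hc, smul_smul, div_mul_cancel₀ _ hl₀.ne']
  -- Finiteness of the set of cells at the edge gives one `ε` for all of them.
  have hev : ∀ᶠ ε in nhdsWithin (0 : ℝ) (Set.Ioi 0), ∀ c ∈ S, ∀ a ∈ c, ∀ b ∈ c,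
      ((a = b ∨ K.graph.Adj a b) ∧ ¬ (a = v ∧ b = w) ∧ ¬ (a = w ∧ b = v)) →
      ∀ t ∈ Set.Icc (0 : ℝ) 1,
        ε ≤ dist (AffineMap.lineMap (E.pos c a) (E.pos c b) t : EPlane) (x₀ c) := by
    refine (Filter.eventually_all_finite hSfin).2 fun c hc => ?_
    refine eventually_le_dist_boundary (E := E) (r := fun a b =>
      (a = b ∨ K.graph.Adj a b) ∧ ¬ (a = v ∧ b = w) ∧ ¬ (a = w ∧ b = v))
      fun a ha b hb hab t _ => ?_
    rw [hx₀' c hc]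
    exact lineMap_ne_of_edge hc.1 hc.2.1 hc.2.2 hvw (div_pos hr hl₀) ((div_lt_one hl₀).2 hr')
      ha hb hab t
  obtain ⟨ε, hε, hpos⟩ := (hev.and self_mem_nhdsWithin).exists
  refine ⟨ε / 2, half_pos hpos, fun A B hAB σ hσ c c' y y' P P' hv hw hv' hw' hP hP' hy hy' => ?_⟩
  have hc : c ∈ S := ⟨hP.1, hv, hw⟩
  have hc' : c' ∈ S := ⟨hP'.1, hv', hw'⟩
  -- On the edge the second coordinate is zero, so the values in different cells agree whatever the
  -- signs `σ c` are.
  have hedge : ∀ c ∈ S, ∀ s : ℝ, foldedHeight (E.edgeDir c v w) A (σ c * B)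
      (s • E.edgeDir c v w) = A * s := fun c hc s => by
    have h₁ : inner ℝ (E.edgeDir c v w) (s • E.edgeDir c v w) = s := by
      rw [real_inner_smul_right, real_inner_self_eq_norm_sq, hnorm c hc]
      ring
    rw [foldedHeight_eq (hnorm c hc) h₁ (η := 0) _ le_rfl, mul_zero, add_zero]
    rw [norm_smul, hnorm c hc, mul_one, Real.norm_eq_abs, sq_abs]
    ring
  have key := abs_sub_le_dist_of_local hd S x₀
    (fun c z => foldedHeight (E.edgeDir c v w) A (σ c * B) (z - E.pos c v) - A * r) (ε := ε)
    ?_ ?_ ?_ hc hc' hP hP' ?_ ?_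
  · simpa using key
  · intro c hc y z
    rw [sub_sub_sub_cancel_right]
    refine (abs_foldedHeight_sub_le (hnorm c hc) ?_ _ _).trans_eq ?_
    · rw [mul_pow, hσ, one_mul, hAB]
    · rw [sub_sub_sub_cancel_right, dist_eq_norm]
  · intro c hc
    simp only [hx₀, add_sub_cancel_left]
    rw [hedge c hc, sub_self]
  · rintro ⟨⟨c₁, hc₁⟩, z₁, hz₁⟩ ⟨⟨c₂, hc₂⟩, z₂, hz₂⟩ ⟨a, b, hab, h₁, h₂, h₃, h₄, t, ht, h₅, h₆⟩
      (hS₁ : c₁ ∈ S) hlt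
    simp only at h₁ h₂ h₃ h₄ h₅ h₆ hlt ⊢
    have hcase : (a = v ∧ b = w) ∨ (a = w ∧ b = v) := by
      by_contra hne
      rw [not_or] at hne
      exact absurd hlt (not_lt.2 (h₅ ▸ hε c₁ hS₁ a h₁ b h₂ ⟨hab, hne⟩ t ht))
    have hS₂ : c₂ ∈ S := by
      rcases hcase with ⟨rfl, rfl⟩ | ⟨rfl, rfl⟩
      · exact ⟨hc₂, h₃, h₄⟩
      · exact ⟨hc₂, h₄, h₃⟩
    obtain ⟨s, hs⟩ : ∃ s : ℝ, ∀ c ∈ S, (AffineMap.lineMap (E.pos c a) (E.pos c b) t : EPlane) =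
        E.pos c v + s • E.edgeDir c v w := by
      rcases hcase with ⟨rfl, rfl⟩ | ⟨rfl, rfl⟩
      · refine ⟨t * l, fun c hc => ?_⟩
        rw [mul_smul, hlen c hc, AffineMap.lineMap_apply, vsub_eq_sub, vadd_eq_add, add_comm]
      · refine ⟨(1 - t) * l, fun c hc => ?_⟩
        rw [mul_smul, hlen c hc, AffineMap.lineMap_apply, vsub_eq_sub, vadd_eq_add]
        module
    have hz₁ := h₅.trans (hs c₁ hS₁)
    have hz₂ := h₆.trans (hs c₂ hS₂)
    have hdist : ∀ c ∈ S, dist (E.pos c v + s • E.edgeDir c v w) (x₀ c) = |s - r| := fun c hc => by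
      rw [hx₀, dist_add_left, dist_eq_norm, ← sub_smul, norm_smul, hnorm c hc, mul_one,
        Real.norm_eq_abs]
    refine ⟨hS₂, ?_, ?_⟩
    · rw [hz₁, hz₂, hdist c₁ hS₁, hdist c₂ hS₂]
    · rw [hz₁, hz₂, add_sub_cancel_left, add_sub_cancel_left, hedge c₁ hS₁, hedge c₂ hS₂]
  · rwa [hx₀, dist_add_left, dist_eq_norm]
  · rwa [hx₀, dist_add_left, dist_eq_norm]

end EuclideanStructure

end PolygonComplex

/-! ### Walks and cycles in the link of a vertex -/

namespace PolygonComplex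

variable {V : Type*} {K : PolygonComplex V}

/-- An infinite walk without backtracking in the link of `v`. -/
structure LinkWalk (K : PolygonComplex V) (v : V) where
  w : ℕ → V
  c : ℕ → Finset V
  mem_twoCells : ∀ i, c i ∈ K.twoCells
  center_mem : ∀ i, v ∈ c i
  left_mem : ∀ i, w i ∈ c i
  right_mem : ∀ i, w (i + 1) ∈ c i
  adj : ∀ i, K.graph.Adj v (w i)
  ne_succ : ∀ i, w i ≠ w (i + 1)
  cell_ne_succ : ∀ i, c (i + 1) ≠ c i

namespace LinkWalk

variable {v : V}

/-- The walk without its first steps. -/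
def drop (W : LinkWalk K v) (k : ℕ) : LinkWalk K v where
  w i := W.w (k + i)
  c i := W.c (k + i)
  mem_twoCells _ := W.mem_twoCells _
  center_mem _ := W.center_mem _
  left_mem _ := W.left_mem _
  right_mem _ := W.right_mem _
  adj _ := W.adj _
  ne_succ _ := W.ne_succ _
  cell_ne_succ _ := W.cell_ne_succ _

theorem eq_or_eq (W : LinkWalk K v) {i : ℕ} {x : V} (hx : x ∈ W.c i) (hvx : K.graph.Adj v x) :
    x = W.w i ∨ x = W.w (i + 1) := by
  obtain ⟨a, b, -, -, -, -, -, h⟩ := exists_two_neighbors (W.mem_twoCells i) (W.center_mem i)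
  have h₁ := h _ (W.left_mem i) (W.adj i)
  have h₂ := h _ (W.right_mem i) (W.adj (i + 1))
  have h₃ := h _ hx hvx
  have h₄ := W.ne_succ i
  grind

end LinkWalk

/-- From a cell of the closing family and an edge of it at `v`, cross the cell to its other edge at
`v`, pass to a different member containing that edge, and iterate. -/
theorem IsInterior.nonempty_linkWalk {v : V} (hv : K.IsInterior v) : Nonempty (LinkWalk K v) := by
  obtain ⟨F, ⟨c₀, hc₀⟩, hF, hclose⟩ := hv
  let T := {s : Finset V × V // s.1 ∈ F ∧ s.2 ∈ s.1 ∧ K.graph.Adj v s.2}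
  have hstep : ∀ s : T, ∃ s' : T, s'.1.2 ∈ s.1.1 ∧ s'.1.2 ≠ s.1.2 ∧ s'.1.1 ≠ s.1.1 := by
    rintro ⟨⟨c, w⟩, hc, hw, hvw⟩
    obtain ⟨a, b, hab, ha, hb, hva, hvb, -⟩ := exists_two_neighbors (hF c hc).1 (hF c hc).2
    obtain ⟨x, hx, hvx, hxw⟩ : ∃ x ∈ c, K.graph.Adj v x ∧ x ≠ w := by
      by_cases h : a = w
      · exact ⟨b, hb, hvb, fun h' => hab (h.trans h'.symm)⟩
      · exact ⟨a, ha, hva, h⟩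
    obtain ⟨c', hc', hne, hxc'⟩ := hclose c hc x hx hvx
    exact ⟨⟨⟨c', x⟩, hc', hxc', hvx⟩, hx, hxw, hne⟩
  choose step h₁ h₂ h₃ using hstep
  obtain ⟨a, -, -, ha, -, hva, -⟩ := exists_two_neighbors (hF c₀ hc₀).1 (hF c₀ hc₀).2
  let s : ℕ → T := fun i => step^[i] ⟨⟨c₀, a⟩, hc₀, ha, hva⟩
  have hs : ∀ i, s (i + 1) = step (s i) := fun i => Function.iterate_succ_apply' _ _ _
  exact ⟨{
    w := fun i => (s i).1.2
    c := fun i => (s i).1.1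
    mem_twoCells := fun i => (hF _ (s i).2.1).1
    center_mem := fun i => (hF _ (s i).2.1).2
    left_mem := fun i => (s i).2.2.1
    right_mem := fun i => by rw [hs]; exact h₁ _
    adj := fun i => (s i).2.2.2
    ne_succ := fun i => by rw [hs]; exact (h₂ _).symm
    cell_ne_succ := fun i => by rw [hs]; exact h₃ _ }⟩

/-- If there are only finitely many cells at an interior vertex, its link contains a cycle. -/
theorem IsInterior.exists_cycle {v : V} (hv : K.IsInterior v)
    (hfin : {c | c ∈ K.twoCells ∧ v ∈ c}.Finite) :
    ∃ (W : LinkWalk K v) (n : ℕ), 2 ≤ n ∧ W.w n = W.w 0 ∧ ∀ i < n, ∀ j < n, W.c i = W.c j → i = j := by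
  classical
  obtain ⟨W⟩ := hv.nonempty_linkWalk
  have hfin' : (⋃ c ∈ {c | c ∈ K.twoCells ∧ v ∈ c}, (c : Set V)).Finite :=
    hfin.biUnion fun c _ => c.finite_toSet
  obtain ⟨i, j, hij, hw⟩ := hfin'.exists_lt_map_eq_of_forall_mem (f := W.w) fun i =>
    Set.mem_biUnion (show W.c i ∈ {c | c ∈ K.twoCells ∧ v ∈ c} from
      ⟨W.mem_twoCells i, W.center_mem i⟩) (W.left_mem i)
  -- Take the shortest return over all starting points. Within it, a repeated cell would repeat one
  -- of its two link vertices too early, unless the two occurrences are consecutive, which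
  -- `cell_ne_succ` excludes.
  have hex : ∃ d, 0 < d ∧ ∃ i, W.w (i + d) = W.w i :=
    ⟨j - i, by omega, i, by rw [Nat.add_sub_cancel' hij.le, hw]⟩
  obtain ⟨hd, k, hk⟩ := Nat.find_spec hex
  have hmin : ∀ a b, a < b → b - a < Nat.find hex → W.w a ≠ W.w b := fun a b hab hlt h =>
    Nat.find_min hex hlt ⟨by omega, a, by rw [Nat.add_sub_cancel' hab.le, h]⟩
  set n := Nat.find hex
  have hn : 2 ≤ n := by
    by_contra hn
    have h₁ : n = 1 := by omega
    rw [h₁] at hk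
    exact W.ne_succ k hk.symm
  have hlt : ∀ i j, i < j → j < n → W.c (k + i) ≠ W.c (k + j) := by
    intro i j hij hjn h
    have h₁ := W.eq_or_eq (i := k + i) (h ▸ W.left_mem (k + j)) (W.adj _)
    have h₂ := W.eq_or_eq (i := k + i) (h ▸ W.right_mem (k + j)) (W.adj _)
    rcases h₁ with h₁ | h₁
    · exact hmin (k + i) (k + j) (by omega) (by omega) h₁.symm
    · have hji : j = i + 1 := by
        by_contra hne
        exact hmin (k + i + 1) (k + j) (by omega) (by omega) h₁.symm
      subst hji
      exact W.cell_ne_succ (k + i) h.symm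
  refine ⟨W.drop k, n, hn, hk, fun i hi j hj h => ?_⟩
  rcases lt_trichotomy i j with hij | hij | hij
  · exact absurd h (hlt i j hij hj)
  · exact hij
  · exact absurd h.symm (hlt j i hij hi)

end PolygonComplex

/-! ### Chords in polar coordinates -/

/-- The distance from the origin of the point at height `y` on the line at distance `h`. -/
noncomputable def chordRadius (h y : ℝ) : ℝ := √(h ^ 2 + y ^ 2)

/-- The angular coordinate of the point at height `y` on the line at distance `h`, whose foot has
angular coordinate `κ`, and which is traversed in the direction given by the sign `σ`. -/
noncomputable def chordAngle (h κ σ y : ℝ) : ℝ := κ + σ * Real.arctan (y / h)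

theorem chordRadius_pos {h : ℝ} (hh : 0 < h) (y : ℝ) : 0 < chordRadius h y :=
  Real.sqrt_pos.2 (by positivity)

theorem chordRadius_sq {h : ℝ} (y : ℝ) : chordRadius h y ^ 2 = h ^ 2 + y ^ 2 :=
  Real.sq_sqrt (by positivity)

theorem chordRadius_eq {h : ℝ} (hh : 0 < h) (y : ℝ) :
    chordRadius h y = h * √(1 + (y / h) ^ 2) := by
  rw [chordRadius, show h ^ 2 + y ^ 2 = h ^ 2 * (1 + (y / h) ^ 2) by field_simp,
    Real.sqrt_mul (by positivity), Real.sqrt_sq hh.le]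

theorem chordRadius_mul_cos_arctan {h : ℝ} (hh : 0 < h) (y : ℝ) :
    chordRadius h y * Real.cos (Real.arctan (y / h)) = h := by
  have : √(1 + (y / h) ^ 2) ≠ 0 := (Real.sqrt_pos.2 (by positivity)).ne'
  rw [chordRadius_eq hh, Real.cos_arctan]
  field_simp

theorem chordRadius_mul_sin_arctan {h : ℝ} (hh : 0 < h) (y : ℝ) :
    chordRadius h y * Real.sin (Real.arctan (y / h)) = y := by
  have : √(1 + (y / h) ^ 2) ≠ 0 := (Real.sqrt_pos.2 (by positivity)).ne'
  rw [chordRadius_eq hh, Real.sin_arctan]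
  field_simp

/-- Both sides are the inner product of the points `(h, y)` and `(h, z)` of a line at distance `h`
from the origin. -/
theorem chordRadius_mul_cos_sub {h σ : ℝ} (hh : 0 < h) (hσ : σ = 1 ∨ σ = -1) (κ y z : ℝ) :
    chordRadius h y * chordRadius h z * Real.cos (chordAngle h κ σ y - chordAngle h κ σ z) =
      h ^ 2 + y * z := by
  have h₁ : Real.cos (chordAngle h κ σ y - chordAngle h κ σ z) =
      Real.cos (Real.arctan (y / h) - Real.arctan (z / h)) := by
    rcases hσ with rfl | rfl
    · congr 1
      simp only [chordAngle]
      ring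
    · rw [← Real.cos_neg]
      congr 1
      simp only [chordAngle]
      ring
  rw [h₁, Real.cos_sub]
  linear_combination
    (chordRadius h z * Real.cos (Real.arctan (z / h))) * chordRadius_mul_cos_arctan hh y +
    h * chordRadius_mul_cos_arctan hh z +
    (chordRadius h z * Real.sin (Real.arctan (z / h))) * chordRadius_mul_sin_arctan hh y +
    y * chordRadius_mul_sin_arctan hh z

theorem continuous_chordAngle (h κ σ : ℝ) : Continuous (chordAngle h κ σ) := by
  unfold chordAngle
  fun_prop

theorem chordAngle_le_chordAngle {h σ : ℝ} (hh : 0 < h) (hσ : σ = 1 ∨ σ = -1) (κ : ℝ) {y z : ℝ}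
    (hyz : 0 ≤ σ * (z - y)) : chordAngle h κ σ y ≤ chordAngle h κ σ z := by
  unfold chordAngle
  rcases hσ with rfl | rfl
  · have := Real.arctan_mono (div_le_div_of_nonneg_right (show y ≤ z by linarith) hh.le)
    linarith
  · have := Real.arctan_mono (div_le_div_of_nonneg_right (show z ≤ y by linarith) hh.le)
    linarith

theorem smul_sectorPoint (A B : EPlane) (r φ : ℝ) :
    r • sectorPoint A B 1 φ = sectorPoint A B r φ := by
  simp only [sectorPoint]
  module

section

variable {A B : EPlane} (hs : Real.sin (InnerProductGeometry.angle A B) ≠ 0) (hA : A ≠ 0)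
  (hB : B ≠ 0) {h σ : ℝ} (hh : 0 < h) (hσ : σ = 1 ∨ σ = -1) (κ S : ℝ)

include hs hA hB

theorem norm_sectorPoint_sq (r φ : ℝ) : ‖sectorPoint A B r φ‖ ^ 2 = r ^ 2 := by
  rw [← real_inner_self_eq_norm_sq, inner_sectorPoint hs hA hB, sub_self, Real.cos_zero]
  ring

include hh hσ

/-- By the law of cosines, a chord is parametrized by arc length in every cell it crosses. -/
theorem norm_sectorPoint_chord_sub (y z : ℝ) :
    ‖sectorPoint A B (chordRadius h y) (chordAngle h κ σ y - S) -
      sectorPoint A B (chordRadius h z) (chordAngle h κ σ z - S)‖ = |y - z| := by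
  rw [← sq_eq_sq₀ (norm_nonneg _) (abs_nonneg _), norm_sub_sq_real,
    norm_sectorPoint_sq hs hA hB, norm_sectorPoint_sq hs hA hB, inner_sectorPoint hs hA hB,
    sub_sub_sub_cancel_right, chordRadius_mul_cos_sub hh hσ, chordRadius_sq, chordRadius_sq, sq_abs]
  ring

/-- The weights are the components of the chord's direction along and across the ray through its
point `y₀`. The sign `s` undoes the folding, so that the function returns the arc length parameter.
-/
theorem foldedHeight_sectorPoint_chord {y₀ y s : ℝ} (hsgn : s * |y - y₀| = y - y₀) :
    foldedHeight (sectorPoint A B 1 (chordAngle h κ σ y₀ - S)) (y₀ / chordRadius h y₀)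
      (s * (h / chordRadius h y₀))
      (sectorPoint A B (chordRadius h y) (chordAngle h κ σ y - S)) = y := by
  have hρ := (chordRadius_pos hh y₀).ne'
  have hρ₂ := chordRadius_sq (h := h) y₀
  have he : ‖sectorPoint A B 1 (chordAngle h κ σ y₀ - S)‖ = 1 := by
    rw [← sq_eq_sq₀ (norm_nonneg _) zero_le_one, norm_sectorPoint_sq hs hA hB]
  rw [foldedHeight_eq he (ξ := (h ^ 2 + y₀ * y) / chordRadius h y₀)
    (η := h * |y - y₀| / chordRadius h y₀)]
  · rw [show s * (h / chordRadius h y₀) * (h * |y - y₀| / chordRadius h y₀)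
      = h ^ 2 * (s * |y - y₀|) / chordRadius h y₀ ^ 2 by ring, hsgn,
      show y₀ / chordRadius h y₀ * ((h ^ 2 + y₀ * y) / chordRadius h y₀)
      = y₀ * (h ^ 2 + y₀ * y) / chordRadius h y₀ ^ 2 by ring, hρ₂]
    have : h ^ 2 + y₀ ^ 2 ≠ 0 := by positivity
    field_simp
    ring
  · rw [inner_sectorPoint hs hA hB, sub_sub_sub_cancel_right, eq_div_iff hρ,
      ← chordRadius_mul_cos_sub hh hσ κ]
    ring
  · rw [norm_sectorPoint_sq hs hA hB, chordRadius_sq, div_pow, div_pow, mul_pow, sq_abs, hρ₂]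
    have : h ^ 2 + y₀ ^ 2 ≠ 0 := by positivity
    field_simp
    ring
  · have := chordRadius_pos hh y₀
    positivity

end

/-! ### Polar coordinates around a vertex -/

namespace PolygonComplex.LinkWalk

open EuclideanStructure

variable {V : Type*} {K : PolygonComplex V} {v : V} (E : K.EuclideanStructure) (W : LinkWalk K v)

/-- The vector along the first edge of the `i`-th corner. -/
noncomputable def left (i : ℕ) : EPlane := E.pos (W.c i) (W.w i) - E.pos (W.c i) v

/-- The vector along the second edge of the `i`-th corner. -/
noncomputable def right (i : ℕ) : EPlane := E.pos (W.c i) (W.w (i + 1)) - E.pos (W.c i) v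

/-- The angle of the `i`-th corner. -/
noncomputable def corner (i : ℕ) : ℝ := InnerProductGeometry.angle (W.left E i) (W.right E i)

/-- The sum of the angles of the first `i` corners. -/
noncomputable def total (i : ℕ) : ℝ := ∑ j ∈ Finset.range i, W.corner E j

/-- The point with polar coordinates `(r, φ)`, in the `i`-th cell. -/
noncomputable def point (i : ℕ) (r φ : ℝ) : EPlane :=
  E.pos (W.c i) v + sectorPoint (W.left E i) (W.right E i) r (φ - W.total E i)

variable {W}

theorem mem_cells (i : ℕ) : W.c i ∈ K.cells := twoCells_subset_cells (W.mem_twoCells i)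

variable {E}

theorem left_ne_zero (i : ℕ) : W.left E i ≠ 0 :=
  sub_ne_zero.2 (pos_ne (mem_cells i) (W.left_mem i) (W.center_mem i) (W.adj i).ne')

theorem right_ne_zero (i : ℕ) : W.right E i ≠ 0 :=
  sub_ne_zero.2 (pos_ne (mem_cells i) (W.right_mem i) (W.center_mem i) (W.adj (i + 1)).ne')

theorem sin_corner_pos (i : ℕ) : 0 < Real.sin (W.corner E i) :=
  EuclideanStructure.sin_corner_pos (mem_cells i) (W.center_mem i) (W.left_mem i) (W.right_mem i)
    (W.ne_succ i) (W.adj i) (W.adj (i + 1))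

theorem corner_le_pi (i : ℕ) : W.corner E i ≤ Real.pi := InnerProductGeometry.angle_le_pi _ _

theorem corner_pos (i : ℕ) : 0 < W.corner E i := by
  refine lt_of_le_of_ne (InnerProductGeometry.angle_nonneg _ _) fun h => ?_
  have : 0 < Real.sin (W.corner E i) := sin_corner_pos i
  rw [← h, Real.sin_zero] at this
  exact this.false

theorem total_zero : W.total E 0 = 0 := rfl

theorem total_succ (i : ℕ) : W.total E (i + 1) = W.total E i + W.corner E i :=
  Finset.sum_range_succ _ _

theorem total_strictMono : StrictMono (W.total E) :=
  strictMono_nat_of_lt_succ fun i => by rw [total_succ]; linarith [corner_pos (E := E) (W := W) i]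

theorem exists_sector {n : ℕ} (hn : 0 < n) {φ : ℝ} (hφ : φ ∈ Set.Icc 0 (W.total E n)) :
    ∃ i < n, φ ∈ Set.Icc (W.total E i) (W.total E (i + 1)) := by
  induction n with
  | zero => omega
  | succ n ih =>
    by_cases h : W.total E n ≤ φ
    · exact ⟨n, by omega, h, hφ.2⟩
    · rcases n.eq_zero_or_pos with rfl | hn
      · exact absurd hφ.1 h
      · obtain ⟨i, hi, h'⟩ := ih hn ⟨hφ.1, (not_le.1 h).le⟩
        exact ⟨i, by omega, h'⟩

/-- Nearby angles belong to a common sector. -/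
theorem eventually_common_sector {n : ℕ} (hn : 0 < n) (φ₀ : ℝ) :
    ∀ᶠ φ in nhds φ₀, φ₀ ∈ Set.Icc 0 (W.total E n) → φ ∈ Set.Icc 0 (W.total E n) →
      ∃ i < n, φ₀ ∈ Set.Icc (W.total E i) (W.total E (i + 1)) ∧
        φ ∈ Set.Icc (W.total E i) (W.total E (i + 1)) := by
  -- Strict inequalities with the finitely many breakpoints persist near `φ₀`; hence any sector
  -- containing `φ` contains `φ₀`.
  have h : ∀ᶠ φ in nhds φ₀, ∀ i ∈ Finset.range (n + 1),
      (φ₀ < W.total E i → φ < W.total E i) ∧ (W.total E i < φ₀ → W.total E i < φ) := by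
    refine (Filter.eventually_all_finset _).2 fun i _ => ?_
    rcases lt_trichotomy φ₀ (W.total E i) with h | h | h
    · filter_upwards [Iio_mem_nhds h] with φ hφ
      exact ⟨fun _ => hφ, fun h' => absurd h' h.not_gt⟩
    · exact Filter.Eventually.of_forall fun φ => ⟨fun h' => absurd h' (by simp [h]),
        fun h' => absurd h' (by simp [h])⟩
    · filter_upwards [Ioi_mem_nhds h] with φ hφ
      exact ⟨fun h' => absurd h' h.not_gt, fun _ => hφ⟩
  filter_upwards [h] with φ hφ _ hφn
  obtain ⟨i, hi, h₁, h₂⟩ := exists_sector hn hφn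
  refine ⟨i, hi, ⟨?_, ?_⟩, h₁, h₂⟩
  · by_contra hlt
    exact absurd h₁ (not_le.2 ((hφ i (Finset.mem_range.2 (by omega))).1 (not_le.1 hlt)))
  · by_contra hlt
    exact absurd h₂ (not_le.2 ((hφ (i + 1) (Finset.mem_range.2 (by omega))).2 (not_le.1 hlt)))

theorem edgeDir_left (i : ℕ) :
    E.edgeDir (W.c i) v (W.w i) = sectorPoint (W.left E i) (W.right E i) 1 0 := by
  rw [sectorPoint_zero_angle (sin_corner_pos i).ne', one_smul]
  rfl

theorem edgeDir_right (i : ℕ) : E.edgeDir (W.c i) v (W.w (i + 1)) =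
    sectorPoint (W.left E i) (W.right E i) 1 (W.corner E i) := by
  rw [corner, sectorPoint_angle (sin_corner_pos i).ne', one_smul]
  rfl

variable (E W) in
/-- The sectors of radius `R` of the first `n` corners lie in their cells. -/
def IsSmallRadius (n : ℕ) (R : ℝ) : Prop :=
  0 < R ∧ ∀ i < n, R * (‖W.left E i‖⁻¹ + ‖W.right E i‖⁻¹) < Real.sin (W.corner E i)

theorem exists_isSmallRadius (n : ℕ) : ∃ R, W.IsSmallRadius E n R := by
  have h : ∀ᶠ R in nhdsWithin (0 : ℝ) (Set.Ioi 0), ∀ i ∈ Finset.range n,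
      R * (‖W.left E i‖⁻¹ + ‖W.right E i‖⁻¹) < Real.sin (W.corner E i) := by
    refine (Filter.eventually_all_finset _).2 fun i _ => ?_
    have hc : Filter.Tendsto (fun R : ℝ => R * (‖W.left E i‖⁻¹ + ‖W.right E i‖⁻¹)) (nhds 0)
        (nhds (0 * (‖W.left E i‖⁻¹ + ‖W.right E i‖⁻¹))) := Filter.tendsto_id.mul_const _
    rw [zero_mul] at hc
    exact (hc.mono_left nhdsWithin_le_nhds).eventually_lt_const (sin_corner_pos i)
  obtain ⟨R, hR, hpos⟩ := (h.and self_mem_nhdsWithin).exists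
  exact ⟨R, hpos, fun i hi => hR i (Finset.mem_range.2 hi)⟩

theorem IsSmallRadius.lt_norm {n : ℕ} {R : ℝ} (hR : W.IsSmallRadius E n R) {i : ℕ} (hi : i < n) :
    R < ‖W.left E i‖ ∧ R < ‖W.right E i‖ := by
  have h := (hR.2 i hi).trans_le (Real.sin_le_one _)
  have h₁ : 0 < ‖W.left E i‖⁻¹ := inv_pos.2 (norm_pos_iff.2 (left_ne_zero i))
  have h₂ : 0 < ‖W.right E i‖⁻¹ := inv_pos.2 (norm_pos_iff.2 (right_ne_zero i))
  have h₃ := mul_pos hR.1 h₁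
  have h₄ := mul_pos hR.1 h₂
  rw [mul_add] at h
  constructor
  · by_contra hle
    linarith [(one_le_div (norm_pos_iff.2 (left_ne_zero i))).2 (not_lt.1 hle),
      div_eq_mul_inv R ‖W.left E i‖]
  · by_contra hle
    linarith [(one_le_div (norm_pos_iff.2 (right_ne_zero i))).2 (not_lt.1 hle),
      div_eq_mul_inv R ‖W.right E i‖]

theorem point_eq (i : ℕ) (r φ : ℝ) : W.point E i r φ = E.pos (W.c i) v +
    ((r * (Real.sin (W.corner E i - (φ - W.total E i)) / Real.sin (W.corner E i)) *
        ‖W.left E i‖⁻¹) • (E.pos (W.c i) (W.w i) - E.pos (W.c i) v) +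
      (r * (Real.sin (φ - W.total E i) / Real.sin (W.corner E i)) *
        ‖W.right E i‖⁻¹) • (E.pos (W.c i) (W.w (i + 1)) - E.pos (W.c i) v)) := by
  simp only [point, sectorPoint, mul_smul]
  rfl

/-- The two terms are the weights of the point at the outer ends of the corner. Their sum being less
than `1` keeps the point inside the triangle spanned by `v` and these ends. -/
theorem IsSmallRadius.coeff_lt {n : ℕ} {R : ℝ} (hR : W.IsSmallRadius E n R) {i : ℕ} (hi : i < n)
    {r : ℝ} (hr : 0 ≤ r) (hrR : r ≤ R) (φ : ℝ) :
    r * (Real.sin (W.corner E i - φ) / Real.sin (W.corner E i)) * ‖W.left E i‖⁻¹ +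
      r * (Real.sin φ / Real.sin (W.corner E i)) * ‖W.right E i‖⁻¹ < 1 := by
  have hs := sin_corner_pos (E := E) (W := W) i
  have h₁ : 0 < ‖W.left E i‖⁻¹ := inv_pos.2 (norm_pos_iff.2 (left_ne_zero i))
  have h₂ : 0 < ‖W.right E i‖⁻¹ := inv_pos.2 (norm_pos_iff.2 (right_ne_zero i))
  have h₃ := hR.2 i hi
  rw [show r * (Real.sin (W.corner E i - φ) / Real.sin (W.corner E i)) * ‖W.left E i‖⁻¹ +
      r * (Real.sin φ / Real.sin (W.corner E i)) * ‖W.right E i‖⁻¹ =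
      r * (Real.sin (W.corner E i - φ) * ‖W.left E i‖⁻¹ + Real.sin φ * ‖W.right E i‖⁻¹) /
        Real.sin (W.corner E i) by ring, div_lt_one hs]
  refine lt_of_le_of_lt ?_ h₃
  have h₄ : Real.sin (W.corner E i - φ) * ‖W.left E i‖⁻¹ + Real.sin φ * ‖W.right E i‖⁻¹ ≤
      ‖W.left E i‖⁻¹ + ‖W.right E i‖⁻¹ := by
    nlinarith [Real.sin_le_one (W.corner E i - φ), Real.sin_le_one φ]
  calc _ ≤ r * (‖W.left E i‖⁻¹ + ‖W.right E i‖⁻¹) := mul_le_mul_of_nonneg_left h₄ hr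
    _ ≤ _ := mul_le_mul_of_nonneg_right hrR (by positivity)

theorem IsSmallRadius.point_mem {n : ℕ} {R : ℝ} (hR : W.IsSmallRadius E n R) {i : ℕ} (hi : i < n)
    {r φ : ℝ} (hr : 0 ≤ r) (hrR : r ≤ R) (hφ : φ ∈ Set.Icc (W.total E i) (W.total E (i + 1))) :
    W.point E i r φ ∈ E.carrier (W.c i) := by
  have hs := sin_corner_pos (E := E) (W := W) i
  have hlt := hR.coeff_lt hi hr hrR (φ - W.total E i)
  have hπ := corner_le_pi (E := E) (W := W) i
  have hsucc := total_succ (E := E) (W := W) i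
  have hc₁ : 0 ≤ r * (Real.sin (W.corner E i - (φ - W.total E i)) / Real.sin (W.corner E i)) *
      ‖W.left E i‖⁻¹ := by
    have := Real.sin_nonneg_of_nonneg_of_le_pi (x := W.corner E i - (φ - W.total E i))
      (by linarith [hφ.2]) (by linarith [hφ.1])
    positivity
  have hc₂ : 0 ≤ r * (Real.sin (φ - W.total E i) / Real.sin (W.corner E i)) *
      ‖W.right E i‖⁻¹ := by
    have := Real.sin_nonneg_of_nonneg_of_le_pi (x := φ - W.total E i)
      (by linarith [hφ.1]) (by linarith [hφ.2])
    positivity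
  rw [point_eq]
  set s := r * (Real.sin (W.corner E i - (φ - W.total E i)) / Real.sin (W.corner E i)) *
      ‖W.left E i‖⁻¹
  set t := r * (Real.sin (φ - W.total E i) / Real.sin (W.corner E i)) * ‖W.right E i‖⁻¹
  have hmem : ∀ x ∈ W.c i, E.pos (W.c i) x ∈ E.carrier (W.c i) := fun x hx =>
    subset_convexHull ℝ _ ⟨x, hx, rfl⟩
  have hconv : Convex ℝ (E.carrier (W.c i)) := convex_convexHull ℝ _
  rw [show E.pos (W.c i) v + (s • (E.pos (W.c i) (W.w i) - E.pos (W.c i) v) +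
      t • (E.pos (W.c i) (W.w (i + 1)) - E.pos (W.c i) v)) = (1 - s - t) • E.pos (W.c i) v +
      s • E.pos (W.c i) (W.w i) + t • E.pos (W.c i) (W.w (i + 1)) by module]
  have key := hconv.sum_mem (t := Finset.univ) (w := ![1 - s - t, s, t])
    (z := ![E.pos (W.c i) v, E.pos (W.c i) (W.w i), E.pos (W.c i) (W.w (i + 1))])
    (by simp [Fin.forall_fin_succ, hc₁, hc₂]; linarith) (by simp [Fin.sum_univ_three]; ring)
    (by simp [Fin.forall_fin_succ, hmem _ (W.center_mem i), hmem _ (W.left_mem i),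
      hmem _ (W.right_mem i)])
  simpa [Fin.sum_univ_three] using key

theorem IsSmallRadius.offBoundary_point {n : ℕ} {R : ℝ} (hR : W.IsSmallRadius E n R) {i : ℕ}
    (hi : i < n) {r φ : ℝ} (hr : 0 < r) (hrR : r ≤ R)
    (hφ : φ ∈ Set.Ioo (W.total E i) (W.total E (i + 1))) :
    E.OffBoundary (W.c i) (W.point E i r φ) := by
  have hs := sin_corner_pos (E := E) (W := W) i
  have hlt := hR.coeff_lt hi hr.le hrR (φ - W.total E i)
  have hπ := corner_le_pi (E := E) (W := W) i
  have hsucc := total_succ (E := E) (W := W) i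
  have h₁ : 0 < ‖W.left E i‖⁻¹ := inv_pos.2 (norm_pos_iff.2 (left_ne_zero i))
  have h₂ : 0 < ‖W.right E i‖⁻¹ := inv_pos.2 (norm_pos_iff.2 (right_ne_zero i))
  have h₃ := Real.sin_pos_of_pos_of_lt_pi (x := W.corner E i - (φ - W.total E i))
      (by linarith [hφ.2]) (by linarith [hφ.1])
  have h₄ := Real.sin_pos_of_pos_of_lt_pi (x := φ - W.total E i)
      (by linarith [hφ.1]) (by linarith [hφ.2])
  rw [point_eq]
  exact offBoundary_of_corner (W.mem_twoCells i) (W.center_mem i) (W.left_mem i) (W.right_mem i)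
    (W.ne_succ i) (W.adj i) (W.adj (i + 1)) (by positivity) (by positivity) hlt

theorem norm_right_eq_norm_left {i j : ℕ} (h : W.w (i + 1) = W.w j) :
    ‖W.right E i‖ = ‖W.left E j‖ := by
  rw [right, left, ← dist_eq_norm, ← dist_eq_norm, h]
  exact E.length_eq _ (mem_cells i) _ (mem_cells j) _ _ (W.adj j).symm (h ▸ W.right_mem i)
    (W.center_mem i) (W.left_mem j) (W.center_mem j)

/-- The sectors of two corners with a common edge are glued along this edge. -/
theorem IsSmallRadius.isPoint_of_glued {n : ℕ} {R : ℝ} (hR : W.IsSmallRadius E n R) {i j : ℕ}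
    (hj : j < n) (h : W.w (i + 1) = W.w j) {r : ℝ} (hr : 0 ≤ r) (hrR : r ≤ R)
    {P : E.Realization} (hP : E.IsPoint (W.c i) (W.point E i r (W.total E (i + 1))) P) :
    E.IsPoint (W.c j) (W.point E j r (W.total E j)) P := by
  obtain ⟨hc, hy, rfl⟩ := hP
  refine ⟨mem_cells j, hR.point_mem hj hr hrR ⟨le_rfl, total_strictMono.monotone (by omega)⟩,
    Quot.sound ?_⟩
  have hl := norm_right_eq_norm_left (E := E) h
  have hlt := (hR.lt_norm hj).1
  have hpos : 0 < ‖W.left E j‖ := norm_pos_iff.2 (left_ne_zero j)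
  refine ⟨v, W.w j, Or.inr (W.adj j), W.center_mem j, W.left_mem j, W.center_mem i,
    h ▸ W.right_mem i, r / ‖W.left E j‖, ⟨by positivity, (div_le_one hpos).2 (by linarith)⟩,
    ?_, ?_⟩
  · simp only [point, sub_self, sectorPoint_zero_angle (sin_corner_pos j).ne']
    rw [AffineMap.lineMap_apply, vsub_eq_sub, vadd_eq_add, add_comm, smul_smul, div_eq_mul_inv]
    rfl
  · simp only [point, total_succ, add_sub_cancel_left]
    rw [corner, sectorPoint_angle (sin_corner_pos i).ne', hl, AffineMap.lineMap_apply, vsub_eq_sub,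
      vadd_eq_add, add_comm, smul_smul, div_eq_mul_inv, ← h]
    rfl

/-- The map from polar coordinates to the realization, along the walk. -/
theorem IsSmallRadius.exists_polar {n : ℕ} {R : ℝ} (hR : W.IsSmallRadius E n R) :
    ∃ F : ℝ → ℝ → E.Realization, ∀ r, 0 ≤ r → r ≤ R → ∀ i < n,
      ∀ φ ∈ Set.Icc (W.total E i) (W.total E (i + 1)),
        E.IsPoint (W.c i) (W.point E i r φ) (F r φ) := by
  classical
  have key : ∀ r φ, ∃ P : E.Realization, 0 ≤ r → r ≤ R → ∀ i < n,
      φ ∈ Set.Icc (W.total E i) (W.total E (i + 1)) →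
        E.IsPoint (W.c i) (W.point E i r φ) P := by
    intro r φ
    by_cases hex : (0 ≤ r ∧ r ≤ R) ∧
        ∃ i, i < n ∧ φ ∈ Set.Icc (W.total E i) (W.total E (i + 1))
    · obtain ⟨⟨hr, hrR⟩, hex⟩ := hex
      obtain ⟨hi, hφ⟩ := Nat.find_spec hex
      have hmin : ∀ j, j < n → φ ∈ Set.Icc (W.total E j) (W.total E (j + 1)) →
        Nat.find hex ≤ j := fun j hj h => Nat.find_min' hex ⟨hj, h⟩
      set i := Nat.find hex
      refine ⟨E.toPoint ⟨W.c i, mem_cells i⟩ ⟨_, hR.point_mem hi hr hrR hφ⟩,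
        fun _ _ j hj hφj => ?_⟩
      have hP : E.IsPoint (W.c i) (W.point E i r φ)
        (E.toPoint ⟨W.c i, mem_cells i⟩ ⟨_, hR.point_mem hi hr hrR hφ⟩) := ⟨_, _, rfl⟩
      rcases (hmin j hj hφj).eq_or_lt with rfl | hlt
      · exact hP
      -- Two sectors share an angle only if they are consecutive, and then it is their common
      -- breakpoint, where the cells are glued.
      · have hji : j = i + 1 := by
          have := total_strictMono.le_iff_le.1 (hφj.1.trans hφ.2)
          omega
        have hφ' : φ = W.total E (i + 1) := le_antisymm hφ.2 (hji ▸ hφj.1)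
        generalize E.toPoint ⟨W.c i, mem_cells i⟩ ⟨_, hR.point_mem hi hr hrR hφ⟩ = P at hP ⊢
        have := hR.isPoint_of_glued hj (by rw [hji]) hr hrR (hφ' ▸ hP)
        rw [hφ']
        rwa [hji] at this ⊢
    · refine ⟨E.toPoint ⟨W.c 0, mem_cells 0⟩ ⟨E.pos (W.c 0) v, subset_convexHull ℝ _
        ⟨v, W.center_mem 0, rfl⟩⟩, fun hr hrR i hi hφ => absurd ⟨⟨hr, hrR⟩, i, hi, hφ⟩ hex⟩
  choose F hF using key
  exact ⟨F, fun r hr hrR i hi φ hφ => hF r φ hr hrR i hi hφ⟩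

end PolygonComplex.LinkWalk

/-! ### Chords are local geodesics; cycles in the link are not shorter than `2π` -/

namespace PolygonComplex.LinkWalk

open EuclideanStructure

variable {V : Type*} {K : PolygonComplex V} {v : V} {E : K.EuclideanStructure} {W : LinkWalk K v}
  {n : ℕ} {R : ℝ} {F : ℝ → ℝ → E.Realization}

variable (E W n R F) in
/-- `F` describes the realization near `v` in polar coordinates, up to radius `R`. -/
def IsPolar : Prop :=
  ∀ r, 0 ≤ r → r ≤ R → ∀ i < n, ∀ φ ∈ Set.Icc (W.total E i) (W.total E (i + 1)),
    E.IsPoint (W.c i) (W.point E i r φ) (F r φ)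

/-- The image in the realization of a chord. -/
noncomputable def chord (F : ℝ → ℝ → E.Realization) (h κ σ y : ℝ) : E.Realization :=
  F (chordRadius h y) (chordAngle h κ σ y)

theorem dist_point_chord {h σ : ℝ} (hh : 0 < h) (hσ : σ = 1 ∨ σ = -1) (κ : ℝ) (i : ℕ) (y z : ℝ) :
    dist (W.point E i (chordRadius h y) (chordAngle h κ σ y))
      (W.point E i (chordRadius h z) (chordAngle h κ σ z)) = |y - z| := by
  rw [point, point, dist_add_left, dist_eq_norm]
  exact norm_sectorPoint_chord_sub (sin_corner_pos i).ne' (left_ne_zero i) (right_ne_zero i) hh hσ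
    κ _ y z

variable [MetricSpace E.Realization]
  (hd : ∀ P Q : E.Realization, edist P Q = E.intrinsicEDist P Q) (hF : W.IsPolar E n R F)
  {h κ σ : ℝ} (hh : 0 < h) (hσ : σ = 1 ∨ σ = -1)

include hd hF hh hσ

theorem dist_chord_le {i : ℕ} (hi : i < n) {y z : ℝ} (hy : chordRadius h y ≤ R)
    (hz : chordRadius h z ≤ R)
    (hy' : chordAngle h κ σ y ∈ Set.Icc (W.total E i) (W.total E (i + 1)))
    (hz' : chordAngle h κ σ z ∈ Set.Icc (W.total E i) (W.total E (i + 1))) :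
    dist (chord F h κ σ y) (chord F h κ σ z) ≤ |y - z| := by
  have h₁ := hF _ (chordRadius_pos hh y).le hy i hi _ hy'
  have h₂ := hF _ (chordRadius_pos hh z).le hz i hi _ hz'
  exact (h₁.dist_le hd h₂).trans_eq (dist_point_chord hh hσ κ i y z)

theorem continuousOn_chord (hn : 0 < n) {s : Set ℝ} (hs : ∀ y ∈ s, chordRadius h y ≤ R)
    (hs' : ∀ y ∈ s, chordAngle h κ σ y ∈ Set.Icc 0 (W.total E n)) :
    ContinuousOn (chord F h κ σ) s := by
  intro y hy
  have hev := ((continuous_chordAngle h κ σ).tendsto y).eventually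
    (eventually_common_sector (E := E) (W := W) hn (chordAngle h κ σ y))
  refine tendsto_iff_dist_tendsto_zero.2 ?_
  refine squeeze_zero' (Filter.Eventually.of_forall fun _ => dist_nonneg) (g := fun z => |z - y|)
    ?_ ?_
  · filter_upwards [nhdsWithin_le_nhds hev, self_mem_nhdsWithin] with z hz hzs
    obtain ⟨i, hi, h₁, h₂⟩ := hz (hs' y hy) (hs' z hzs)
    exact dist_chord_le hd hF hh hσ hi (hs z hzs) (hs y hy) h₂ h₁
  · have : Continuous fun z : ℝ => |z - y| := by fun_prop
    simpa using (this.tendsto y).mono_left nhdsWithin_le_nhds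

/-- A chord is a local geodesic at its points in the interior of a cell. -/
theorem IsSmallRadius.dist_chord_of_interior (hR : W.IsSmallRadius E n R) {i : ℕ} (hi : i < n)
    {y₀ : ℝ} (hy : ∀ᶠ y in nhds y₀, chordRadius h y ≤ R)
    (hφ : chordAngle h κ σ y₀ ∈ Set.Ioo (W.total E i) (W.total E (i + 1))) :
    ∃ U ∈ nhds y₀, ∀ y ∈ U, ∀ z ∈ U, dist (chord F h κ σ y) (chord F h κ σ z) = |y - z| := by
  obtain ⟨ε, hε, hiso⟩ := (hR.offBoundary_point hi (chordRadius_pos hh y₀) hy.self_of_nhds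
    hφ).exists_dist_le hd
  have hsec : ∀ᶠ y in nhds y₀, chordAngle h κ σ y ∈ Set.Icc (W.total E i) (W.total E (i + 1)) :=
    ((continuous_chordAngle h κ σ).tendsto y₀).eventually (Icc_mem_nhds hφ.1 hφ.2)
  have hball : ∀ᶠ y in nhds y₀, |y - y₀| ≤ ε := by
    filter_upwards [Metric.closedBall_mem_nhds y₀ hε] with y hy
    exact hy
  refine ⟨_, hy.and (hsec.and hball), fun y hy z hz => le_antisymm
    (dist_chord_le hd hF hh hσ hi hy.1 hz.1 hy.2.1 hz.2.1) ?_⟩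
  have h₁ := hF _ (chordRadius_pos hh y).le hy.1 i hi _ hy.2.1
  have h₂ := hF _ (chordRadius_pos hh z).le hz.1 i hi _ hz.2.1
  rw [← dist_point_chord (E := E) (W := W) hh hσ κ i y z]
  refine hiso _ _ _ _ h₁ h₂ ?_ ?_
  · rw [dist_point_chord hh hσ κ]
    exact hy.2.2
  · rw [dist_point_chord hh hσ κ]
    exact hz.2.2

/-- A chord is a local geodesic at its points in the interior of an edge. -/
theorem IsSmallRadius.dist_chord_of_edge (hR : W.IsSmallRadius E n R)
    (hfin : {c | c ∈ K.twoCells ∧ v ∈ c}.Finite) {i : ℕ} (hi : i + 1 < n)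
    {y₀ : ℝ} (hy : ∀ᶠ y in nhds y₀, chordRadius h y ≤ R)
    (hφ : chordAngle h κ σ y₀ = W.total E (i + 1)) :
    ∃ U ∈ nhds y₀, ∀ y ∈ U, ∀ z ∈ U, dist (chord F h κ σ y) (chord F h κ σ z) = |y - z| := by
  classical
  set ρ := chordRadius h y₀ with hρ
  have hρ₀ : 0 < ρ := chordRadius_pos hh y₀
  obtain ⟨ε, hε, hfold⟩ := exists_foldedHeight_sub_le hd (W.adj (i + 1)) hfin hρ₀
    (mem_cells (W := W) (i + 1)) (W.center_mem _) (W.left_mem _)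
    (by
      rw [dist_comm, dist_eq_norm]
      exact hy.self_of_nhds.trans_lt (hR.lt_norm hi).1)
  have hlt₁ := total_strictMono (E := E) (W := W) (show i < i + 1 by omega)
  have hlt₂ := total_strictMono (E := E) (W := W) (show i + 1 < i + 1 + 1 by omega)
  have hsec : ∀ᶠ y in nhds y₀, chordAngle h κ σ y ∈ Set.Icc (W.total E i) (W.total E (i + 1 + 1)) :=
    ((continuous_chordAngle h κ σ).tendsto y₀).eventually
      (Icc_mem_nhds (hφ ▸ hlt₁) (hφ ▸ hlt₂))
  have hball : ∀ᶠ y in nhds y₀, |y - y₀| ≤ ε := by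
    filter_upwards [Metric.closedBall_mem_nhds y₀ hε] with y hy
    exact hy
  set U : Set ℝ := {y | chordRadius h y ≤ R ∧
    chordAngle h κ σ y ∈ Set.Icc (W.total E i) (W.total E (i + 1 + 1)) ∧ |y - y₀| ≤ ε} with hU
  have hUmem : U ∈ nhds y₀ := hy.and (hsec.and hball)
  have hright : ∀ y ∈ U, 0 ≤ σ * (y - y₀) →
      chordAngle h κ σ y ∈ Set.Icc (W.total E (i + 1)) (W.total E (i + 1 + 1)) := fun y hy hs =>
    ⟨hφ ▸ chordAngle_le_chordAngle hh hσ κ hs, hy.2.1.2⟩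
  have hleft : ∀ y ∈ U, σ * (y - y₀) ≤ 0 →
      chordAngle h κ σ y ∈ Set.Icc (W.total E i) (W.total E (i + 1)) := fun y hy hs =>
    ⟨hy.2.1.1, hφ ▸ chordAngle_le_chordAngle hh hσ κ (by linarith)⟩
  have hy₀ : y₀ ∈ U := mem_of_mem_nhds hUmem
  refine ⟨U, hUmem, ?_⟩
  have hupper : ∀ y ∈ U, ∀ z ∈ U, dist (chord F h κ σ y) (chord F h κ σ z) ≤ |y - z| := by
    have hsame : ∀ y ∈ U, ∀ z ∈ U, 0 ≤ σ * (y - y₀) → 0 ≤ σ * (z - y₀) →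
        dist (chord F h κ σ y) (chord F h κ σ z) ≤ |y - z| := fun y hy z hz h₁ h₂ =>
      dist_chord_le hd hF hh hσ hi hy.1 hz.1 (hright y hy h₁) (hright z hz h₂)
    have hsame' : ∀ y ∈ U, ∀ z ∈ U, σ * (y - y₀) ≤ 0 → σ * (z - y₀) ≤ 0 →
        dist (chord F h κ σ y) (chord F h κ σ z) ≤ |y - z| := fun y hy z hz h₁ h₂ =>
      dist_chord_le hd hF hh hσ (by omega) hy.1 hz.1 (hleft y hy h₁) (hleft z hz h₂)
    -- Points on different sides of the edge are compared through the point `y₀` on it.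
    have hcross : ∀ y ∈ U, ∀ z ∈ U, 0 ≤ σ * (y - y₀) → σ * (z - y₀) ≤ 0 →
        dist (chord F h κ σ y) (chord F h κ σ z) ≤ |y - z| := fun y hy z hz h₁ h₂ => by
      have h₃ := hsame y hy y₀ hy₀ h₁ (by simp)
      have h₄ := hsame' y₀ hy₀ z hz (by simp) h₂
      have h₅ : |y - y₀| + |y₀ - z| = |y - z| := by
        rcases hσ with rfl | rfl
        · rw [abs_of_nonneg (by linarith), abs_of_nonneg (by linarith),
            abs_of_nonneg (by linarith)]
          ring
        · rw [abs_of_nonpos (by linarith), abs_of_nonpos (by linarith),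
            abs_of_nonpos (by linarith)]
          ring
      linarith [dist_triangle (chord F h κ σ y) (chord F h κ σ y₀) (chord F h κ σ z)]
    intro y hy z hz
    rcases le_total 0 (σ * (y - y₀)) with h₁ | h₁ <;> rcases le_total 0 (σ * (z - y₀)) with h₂ | h₂
    · exact hsame y hy z hz h₁ h₂
    · exact hcross y hy z hz h₁ h₂
    · rw [dist_comm, abs_sub_comm]
      exact hcross z hz y hy h₂ h₁
    · exact hsame' y hy z hz h₁ h₂
  -- The cells before and after the edge are folded with opposite signs, which is consistent because
  -- they are different. The folded height is then the parameter `y` on both sides.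
  set sgn : Finset V → ℝ := fun c => if c = W.c (i + 1) then σ else -σ with hsgn
  have hσ₂ : σ ^ 2 = 1 := by rcases hσ with rfl | rfl <;> norm_num
  have hsgn₁ : ∀ c, sgn c ^ 2 = 1 := fun c => by
    simp only [hsgn]
    split_ifs
    · exact hσ₂
    · rw [neg_sq, hσ₂]
  have habs : ∀ y, 0 ≤ σ * (y - y₀) → σ * |y - y₀| = y - y₀ := fun y hy => by
    rcases hσ with rfl | rfl
    · rw [abs_of_nonneg (by linarith)]
      ring
    · rw [abs_of_nonpos (by linarith)]
      ring
  have habs' : ∀ y, σ * (y - y₀) ≤ 0 → -σ * |y - y₀| = y - y₀ := fun y hy => by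
    rcases hσ with rfl | rfl
    · rw [abs_of_nonpos (by linarith)]
      ring
    · rw [abs_of_nonneg (by linarith)]
      ring
  have hcell : ∀ j y s, s * |y - y₀| = y - y₀ → |y - y₀| ≤ ε →
      E.edgeDir (W.c j) v (W.w (i + 1)) = sectorPoint (W.left E j) (W.right E j) 1
        (chordAngle h κ σ y₀ - W.total E j) →
      ‖sectorPoint (W.left E j) (W.right E j) (chordRadius h y)
        (chordAngle h κ σ y - W.total E j) - ρ • E.edgeDir (W.c j) v (W.w (i + 1))‖ ≤ ε ∧
      foldedHeight (E.edgeDir (W.c j) v (W.w (i + 1))) (y₀ / ρ) (s * (h / ρ))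
        (sectorPoint (W.left E j) (W.right E j) (chordRadius h y)
          (chordAngle h κ σ y - W.total E j)) = y := by
    intro j y s hs hy hdir
    rw [hdir, smul_sectorPoint, norm_sectorPoint_chord_sub (sin_corner_pos j).ne' (left_ne_zero j)
      (right_ne_zero j) hh hσ]
    exact ⟨hy, foldedHeight_sectorPoint_chord (sin_corner_pos j).ne' (left_ne_zero j)
      (right_ne_zero j) hh hσ κ _ hs⟩
  have key : ∀ y ∈ U, ∃ c p, v ∈ c ∧ W.w (i + 1) ∈ c ∧
      E.IsPoint c (E.pos c v + p) (chord F h κ σ y) ∧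
      ‖p - ρ • E.edgeDir c v (W.w (i + 1))‖ ≤ ε ∧
      foldedHeight (E.edgeDir c v (W.w (i + 1))) (y₀ / ρ) (sgn c * (h / ρ)) p = y := by
    intro y hy
    rcases le_total 0 (σ * (y - y₀)) with h₁ | h₁
    · have h₂ : sgn (W.c (i + 1)) = σ := if_pos rfl
      refine ⟨W.c (i + 1), _, W.center_mem _, W.left_mem _,
        hF _ (chordRadius_pos hh y).le hy.1 (i + 1) hi _ (hright y hy h₁), ?_⟩
      rw [h₂]
      refine hcell (i + 1) y σ (habs y h₁) hy.2.2 ?_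
      rw [edgeDir_left, hφ, sub_self]
    · have h₂ : sgn (W.c i) = -σ := if_neg (W.cell_ne_succ i).symm
      refine ⟨W.c i, _, W.center_mem _, W.right_mem _,
        hF _ (chordRadius_pos hh y).le hy.1 i (by omega) _ (hleft y hy h₁), ?_⟩
      rw [h₂]
      refine hcell i y (-σ) (habs' y h₁) hy.2.2 ?_
      rw [edgeDir_right, hφ, total_succ, add_sub_cancel_left]
  intro y hy z hz
  refine le_antisymm (hupper y hy z hz) ?_
  obtain ⟨c, p, hc₁, hc₂, hc₃, hc₄, hc₅⟩ := key y hy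
  obtain ⟨c', p', hc₁', hc₂', hc₃', hc₄', hc₅'⟩ := key z hz
  have hAB : (y₀ / ρ) ^ 2 + (h / ρ) ^ 2 = 1 := by
    rw [div_pow, div_pow, ← add_div, add_comm, ← chordRadius_sq, div_self (pow_pos hρ₀ 2).ne']
  have := hfold _ _ hAB sgn hsgn₁ c c' p p' _ _ hc₁ hc₂ hc₁' hc₂' hc₃ hc₃' hc₄ hc₄'
  rwa [hc₅, hc₅'] at this

theorem IsSmallRadius.exists_dist_chord (hR : W.IsSmallRadius E n R)
    (hfin : {c | c ∈ K.twoCells ∧ v ∈ c}.Finite) (hn : 0 < n) {y₀ : ℝ}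
    (hy : ∀ᶠ y in nhds y₀, chordRadius h y ≤ R)
    (hφ : chordAngle h κ σ y₀ ∈ Set.Ioo 0 (W.total E n)) :
    ∃ δ > 0, ∀ y ∈ Set.Icc (y₀ - δ) (y₀ + δ), ∀ z ∈ Set.Icc (y₀ - δ) (y₀ + δ),
      dist (chord F h κ σ y) (chord F h κ σ z) = |y - z| := by
  obtain ⟨U, hU, hdist⟩ : ∃ U ∈ nhds y₀, ∀ y ∈ U, ∀ z ∈ U,
      dist (chord F h κ σ y) (chord F h κ σ z) = |y - z| := by
    obtain ⟨i, hi, h₁, h₂⟩ := exists_sector hn (Set.Ioo_subset_Icc_self hφ)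
    rcases h₁.eq_or_lt with h₁ | h₁
    · obtain ⟨j, rfl⟩ : ∃ j, i = j + 1 := by
        refine Nat.exists_eq_succ_of_ne_zero fun h₀ => ?_
        rw [h₀, total_zero] at h₁
        exact hφ.1.ne h₁
      exact hR.dist_chord_of_edge hd hF hh hσ hfin hi hy h₁.symm
    rcases h₂.eq_or_lt with h₂ | h₂
    · refine hR.dist_chord_of_edge hd hF hh hσ hfin (i := i) ?_ hy h₂
      exact total_strictMono.lt_iff_lt.1 (h₂ ▸ hφ.2)
    · exact hR.dist_chord_of_interior hd hF hh hσ hi hy ⟨h₁, h₂⟩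
  obtain ⟨δ, hδ, hsub⟩ := Metric.nhds_basis_closedBall.mem_iff.1 hU
  rw [Real.closedBall_eq_Icc] at hsub
  exact ⟨δ, hδ, fun y hy z hz => hdist y (hsub hy) z (hsub hz)⟩

omit hF hh hσ in
/-- In a CAT(0) complex, the cycles of the link have length at least `2π`. -/
theorem two_pi_le_total (hcat : IsCAT0 E.Realization)
    (hfin : {c | c ∈ K.twoCells ∧ v ∈ c}.Finite) (hn : 2 ≤ n) (hclosed : W.w n = W.w 0)
    (hne : W.c (n - 1) ≠ W.c 0) : 2 * Real.pi ≤ W.total E n := by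
  by_contra hlt
  rw [not_le] at hlt
  obtain ⟨R, hR⟩ := exists_isSmallRadius (E := E) (W := W) n
  obtain ⟨F, hF⟩ := hR.exists_polar
  replace hF : W.IsPolar E n R F := hF
  set θ := W.total E n with hθ
  have hθ₀ : 0 < θ := total_strictMono (E := E) (W := W) (show 0 < n by omega)
  have hπ := Real.pi_pos
  -- Both chords subtend `θ / 2` and have their feet at the angles `θ / 4` and `3θ / 4`. Here `θ <
  -- 2π` enters: it gives `θ / 4 < π / 2`, so `h > 0` and the chords avoid `v`.
  set h := R * Real.cos (θ / 4) with hh_def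
  set Y := R * Real.sin (θ / 4) with hY_def
  have hh : 0 < h := mul_pos hR.1 (Real.cos_pos_of_mem_Ioo ⟨by linarith, by linarith⟩)
  have hY : 0 < Y := mul_pos hR.1 (Real.sin_pos_of_pos_of_lt_pi (by linarith) (by linarith))
  have hhY : h ^ 2 + Y ^ 2 = R ^ 2 := by
    rw [hh_def, hY_def]
    linear_combination R ^ 2 * Real.sin_sq_add_cos_sq (θ / 4)
  have hYh : Real.arctan (Y / h) = θ / 4 := by
    rw [hY_def, hh_def, mul_div_mul_left _ _ hR.1.ne', ← Real.tan_eq_sin_div_cos,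
      Real.arctan_tan (by linarith) (by linarith)]
  have hYh' : Real.arctan (-Y / h) = -(θ / 4) := by rw [neg_div, Real.arctan_neg, hYh]
  have hρ : ∀ y ∈ Set.Icc (-Y) Y, chordRadius h y ≤ R := fun y hy => by
    refine Real.sqrt_le_iff.2 ⟨hR.1.le, ?_⟩
    nlinarith [hy.1, hy.2]
  have hρY' : chordRadius h (-Y) = R := by rw [chordRadius, neg_sq, hhY, Real.sqrt_sq hR.1.le]
  have hat : ∀ y ∈ Set.Icc (-Y) Y, Real.arctan (y / h) ∈ Set.Icc (-(θ / 4)) (θ / 4) :=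
    fun y hy => by
      rw [← hYh', ← hYh]
      exact ⟨Real.arctan_mono (div_le_div_of_nonneg_right hy.1 hh.le),
        Real.arctan_mono (div_le_div_of_nonneg_right hy.2 hh.le)⟩
  have hat' : ∀ y ∈ Set.Ioo (-Y) Y, Real.arctan (y / h) ∈ Set.Ioo (-(θ / 4)) (θ / 4) :=
    fun y hy => by
      rw [← hYh', ← hYh]
      exact ⟨Real.arctan_strictMono (div_lt_div_of_pos_right hy.1 hh),
        Real.arctan_strictMono (div_lt_div_of_pos_right hy.2 hh)⟩
  have hev : ∀ y ∈ Set.Ioo (-Y) Y, ∀ᶠ y in nhds y, chordRadius h y ≤ R := fun y hy => by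
    filter_upwards [Icc_mem_nhds hy.1 hy.2] with z hz using hρ z hz
  have hα : ∀ y ∈ Set.Icc (-Y) Y, chordAngle h (θ / 4) 1 y ∈ Set.Icc 0 θ := fun y hy => by
    have := hat y hy
    simp only [chordAngle, Set.mem_Icc] at this ⊢
    constructor <;> linarith
  have hβ : ∀ y ∈ Set.Icc (-Y) Y, chordAngle h (3 * θ / 4) (-1) y ∈ Set.Icc 0 θ := fun y hy => by
    have := hat y hy
    simp only [chordAngle, Set.mem_Icc] at this ⊢
    constructor <;> linarith
  have hα' : ∀ y ∈ Set.Ioo (-Y) Y, chordAngle h (θ / 4) 1 y ∈ Set.Ioo 0 θ := fun y hy => by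
    have := hat' y hy
    simp only [chordAngle, Set.mem_Ioo] at this ⊢
    constructor <;> linarith
  have hβ' : ∀ y ∈ Set.Ioo (-Y) Y, chordAngle h (3 * θ / 4) (-1) y ∈ Set.Ioo 0 θ := fun y hy => by
    have := hat' y hy
    simp only [chordAngle, Set.mem_Ioo] at this ⊢
    constructor <;> linarith
  have hα₀ : chordAngle h (θ / 4) 1 (-Y) = W.total E 0 := by
    rw [chordAngle, hYh', total_zero]
    ring
  have hβ₀ : chordAngle h (3 * θ / 4) (-1) (-Y) = W.total E (n - 1 + 1) := by
    rw [chordAngle, hYh', Nat.sub_add_cancel (by omega), ← hθ]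
    ring
  have hmono := total_strictMono (E := E) (W := W)
  -- The angles `0` and `θ` are different parameters of the same ray, since the cycle closes: the
  -- last corner is glued to the first.
  have hstart : chord F h (θ / 4) 1 (-Y) = chord F h (3 * θ / 4) (-1) (-Y) := by
    have h₁ := hF R hR.1.le le_rfl 0 (by omega) _ ⟨le_rfl, hmono.monotone (by omega)⟩
    have h₂ := hF R hR.1.le le_rfl (n - 1) (by omega) _ ⟨hmono.monotone (by omega), le_rfl⟩
    have h₃ := hR.isPoint_of_glued (i := n - 1) (j := 0) (by omega)
      (by rw [Nat.sub_add_cancel (by omega), hclosed]) hR.1.le le_rfl h₂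
    rw [chord, chord, hα₀, hβ₀, hρY', ← dist_le_zero]
    simpa using h₁.dist_le hd h₃
  have hend : chord F h (θ / 4) 1 Y = chord F h (3 * θ / 4) (-1) Y := by
    rw [chord, chord, chordAngle, chordAngle, hYh]
    congr 1
    ring
  have hn₀ : 0 < n := by omega
  have heq : ∀ y ∈ Set.Icc (-Y) Y, chord F h (θ / 4) 1 y = chord F h (3 * θ / 4) (-1) y :=
    fun y hy => hcat.local_geodesic_unique
      (continuousOn_chord hd hF hh (Or.inl rfl) hn₀ hρ hα)
      (continuousOn_chord hd hF hh (Or.inr rfl) hn₀ hρ hβ)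
      (fun y hy => hR.exists_dist_chord hd hF hh (Or.inl rfl) hfin hn₀ (hev y hy) (hα' y hy))
      (fun y hy => hR.exists_dist_chord hd hF hh (Or.inr rfl) hfin hn₀ (hev y hy) (hβ' y hy))
      hstart hend hy
  -- Just after the start the first chord is still inside the first cell and the second one still in
  -- the last cell, so a common point would identify these distinct cells.
  have hev₁ : ∀ᶠ y in nhds (-Y), chordAngle h (θ / 4) 1 y < W.total E 1 :=
    ((continuous_chordAngle _ _ _).tendsto _).eventually_lt_const (hα₀ ▸ hmono zero_lt_one)
  have hev₂ : ∀ᶠ y in nhds (-Y), W.total E (n - 1) < chordAngle h (3 * θ / 4) (-1) y :=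
    ((continuous_chordAngle _ _ _).tendsto _).eventually_const_lt (hβ₀ ▸ hmono (by omega))
  obtain ⟨y, ⟨hy₁, hy₂⟩, hyI⟩ := (((hev₁.and hev₂).filter_mono nhdsWithin_le_nhds).and
    (Ioo_mem_nhdsGT (show -Y < Y by linarith))).exists
  have hyI' := Set.Ioo_subset_Icc_self hyI
  have hr := chordRadius_pos hh y
  have h₁ := hF _ hr.le (hρ y hyI') 0 hn₀ _ ⟨(hα' y hyI).1.le, hy₁.le⟩
  have h₂ := hF _ hr.le (hρ y hyI') (n - 1) (by omega) _
    ⟨hy₂.le, by rw [Nat.sub_add_cancel (by omega)]; exact (hβ y hyI').2⟩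
  have h₃ := heq y hyI'
  rw [chord, chord] at h₃
  rw [← h₃] at h₂
  exact hne (h₁.cell_eq h₂ (hR.offBoundary_point hn₀ hr (hρ y hyI') ⟨(hα' y hyI).1, hy₁⟩))

end PolygonComplex.LinkWalk

/-! ### Counting angles in the subdivision -/

namespace PolygonComplex.LinkWalk

variable {V : Type*} {K : PolygonComplex V} {v : V} (E : K.EuclideanStructure) (W : LinkWalk K v)

theorem ofReal_total_le_angleSum {n : ℕ} (hinj : ∀ i < n, ∀ j < n, W.c i = W.c j → i = j) :
    ENNReal.ofReal (W.total E n) ≤ E.angleSum v := by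
  let f : Fin n → {c : Finset V // c ∈ K.twoCells ∧ v ∈ c} := fun i =>
    ⟨W.c i, W.mem_twoCells i, W.center_mem i⟩
  have hf : Function.Injective f := fun i j h =>
    Fin.ext (hinj i i.2 j j.2 (congrArg Subtype.val h))
  refine le_trans ?_ (ENNReal.tsum_comp_le_tsum_of_injective hf fun c => E.cornerAngle c.1 v)
  rw [tsum_fintype, total, Finset.sum_range, ENNReal.ofReal_sum_of_nonneg fun i _ =>
    (corner_pos _).le]
  refine Finset.sum_le_sum fun i _ => ?_
  exact le_iSup₂_of_le (W.w i) (W.left_mem i) <| le_iSup₂_of_le (W.w (i + 1)) (W.right_mem i) <|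
    le_iSup₂_of_le (W.adj i) (W.adj (i + 1)) le_rfl

end PolygonComplex.LinkWalk

theorem InnerProductGeometry.angle_eq_pi_div_three {x y : EPlane} (hx : x ≠ 0) (h₁ : ‖x‖ = ‖y‖)
    (h₂ : ‖x‖ = ‖x - y‖) : InnerProductGeometry.angle x y = Real.pi / 3 := by
  have hn : ‖x‖ ≠ 0 := norm_ne_zero_iff.2 hx
  rw [InnerProductGeometry.angle, real_inner_eq_norm_mul_self_add_norm_mul_self_sub_norm_sub_mul_self_div_two,
    ← h₁, ← h₂]
  rw [show (‖x‖ * ‖x‖ + ‖x‖ * ‖x‖ - ‖x‖ * ‖x‖) / 2 / (‖x‖ * ‖x‖) = 1 / 2 by field_simp; ring,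
    ← Real.cos_pi_div_three, Real.arccos_cos] <;> linarith [Real.pi_pos]

namespace TrianglePentagonComplex

open PolygonComplex

variable {V : Type*} {X : TrianglePentagonComplex V}

theorem mem_oldTriangle {t : Finset V} {x : X.StarVertex} :
    x ∈ X.oldTriangle t ↔ ∃ a ∈ t, Sum.inl a = x := by
  classical
  simp [oldTriangle]

theorem mem_wheelTriangle {p : X.pentagons} {a b : V} {x : X.StarVertex} :
    x ∈ X.wheelTriangle p a b ↔ x = Sum.inr p ∨ x = Sum.inl a ∨ x = Sum.inl b := by
  classical
  simp [wheelTriangle]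

theorem wheelTriangle_comm (p : X.pentagons) (a b : V) :
    X.wheelTriangle p a b = X.wheelTriangle p b a := by
  ext x
  simp only [mem_wheelTriangle]
  tauto

theorem oldTriangle_injective : Function.Injective X.oldTriangle := by
  classical
  exact Finset.image_injective Sum.inl_injective

theorem mem_star_cells {τ : Finset X.StarVertex} (h : τ ∈ X.star.triangles) : τ ∈ X.star.cells :=
  Or.inr (Or.inr (Or.inl h))

/-- The triangles of the subdivision at the vertex `v` are in bijection with edges of its link. -/
theorem encard_star_triangles_le (v : V) :
    {τ | τ ∈ X.star.triangles ∧ Sum.inl v ∈ τ}.encard ≤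
      combinatorialGirth X.starComplex (Sum.inl v) := by
  classical
  refine Set.encard_le_encard_of_injOn (f := fun τ => τ.erase (Sum.inl v)) ?_ ?_
  · rintro τ ⟨hτ, hv⟩
    have hcl := X.star.triangles_isClique τ hτ
    have hcard : (τ.erase (Sum.inl v)).card = 2 := by
      rw [Finset.card_erase_of_mem hv, hcl.card_eq]
    refine ⟨⟨Or.inr (Or.inl ⟨hcl.isClique.subset ?_, hcard⟩), ?_, τ, mem_star_cells hτ, ?_⟩, hcard⟩
    · exact Finset.coe_subset.2 (Finset.erase_subset _ _)
    · simp
    · ext x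
      by_cases hx : x = Sum.inl v <;> simp [hx, hv]
  · rintro τ ⟨-, hv⟩ τ' ⟨-, hv'⟩ h
    rw [← Finset.insert_erase hv, ← Finset.insert_erase hv']
    exact congrArg _ h

theorem exists_wheelTriangle_mem {p : Finset V} (hp : p ∈ X.pentagons) {v : V} (hv : v ∈ p) :
    ∃ a, a ∈ p ∧ X.graph.Adj v a ∧
      X.wheelTriangle ⟨p, hp⟩ v a ∈ {τ | τ ∈ X.star.triangles ∧ Sum.inl v ∈ τ} := by
  obtain ⟨a, -, -, ha, -, hva, -⟩ := exists_two_neighbors (K := X.toPolygonComplex) (Or.inr hp) hv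
  exact ⟨a, ha, hva, Or.inr ⟨⟨p, hp⟩, v, a, hv, ha, hva, rfl⟩, by simp [mem_wheelTriangle]⟩

/-- Each 2-cell at `v` is recovered from some triangle of the subdivision at `v`: a triangle from
itself, a pentagon from a triangle containing its centre. -/
theorem finite_twoCells {v : V} (h : {τ | τ ∈ X.star.triangles ∧ Sum.inl v ∈ τ}.Finite) :
    {c | c ∈ X.twoCells ∧ v ∈ c}.Finite := by
  have hex : ∀ c ∈ {c | c ∈ X.twoCells ∧ v ∈ c},
      ∃ τ ∈ {τ | τ ∈ X.star.triangles ∧ Sum.inl v ∈ τ},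
        (∀ p : X.pentagons, Sum.inr p ∈ τ → p.1 = c) ∧
          ((∀ p : X.pentagons, Sum.inr p ∉ τ) → τ = X.oldTriangle c) := by
    rintro c ⟨hc | hc, hv⟩
    · exact ⟨X.oldTriangle c, ⟨Or.inl ⟨c, hc, rfl⟩, mem_oldTriangle.2 ⟨v, hv, rfl⟩⟩,
        fun p hp => by simp [mem_oldTriangle] at hp, fun _ => rfl⟩
    · obtain ⟨a, -, -, ha⟩ := exists_wheelTriangle_mem hc hv
      refine ⟨_, ha, fun p hp => ?_, fun hp => ?_⟩
      · simp only [mem_wheelTriangle, Sum.inr.injEq, reduceCtorEq, or_false] at hp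
        rw [hp]
      · exact absurd (mem_wheelTriangle.2 (Or.inl rfl)) (hp ⟨c, hc⟩)
  choose! f hf h₁ h₂ using hex
  refine Set.Finite.of_injOn (f := f) hf (fun c hc c' hc' hcc' => ?_) h
  by_cases hp : ∃ p : X.pentagons, Sum.inr p ∈ f c
  · obtain ⟨p, hp⟩ := hp
    exact (h₁ c hc p hp).symm.trans (h₁ c' hc' p (hcc' ▸ hp))
  · push Not at hp
    exact oldTriangle_injective
      ((h₂ c hc hp).symm.trans (hcc'.trans (h₂ c' hc' (hcc' ▸ hp))))

theorem cornerAngle_wheelTriangle_le {d : X.EuclideanStructure} {dstar : X.star.EuclideanStructure}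
    (hstar : X.IsStarMetric d dstar) (p : X.pentagons) {v a : V} (hv : v ∈ p.1) (ha : a ∈ p.1)
    (hva : X.graph.Adj v a) : dstar.cornerAngle (X.wheelTriangle p v a) (Sum.inl v) ≤
      ENNReal.ofReal (3 * Real.pi / 10) := by
  have hcell : X.wheelTriangle p v a ∈ X.star.cells :=
    mem_star_cells (Or.inr ⟨p, v, a, hv, ha, hva, rfl⟩)
  have hang := (hstar.wheel p v a hv ha hva).2.1
  have hπ := Real.pi_pos
  have hvm : (Sum.inl v : X.StarVertex) ∈ X.wheelTriangle p v a :=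
    mem_wheelTriangle.2 (Or.inr (Or.inl rfl))
  refine iSup₂_le fun x hx => iSup₂_le fun y hy => iSup₂_le fun hvx hvy =>
    ENNReal.ofReal_le_ofReal ?_
  -- The supremum in `cornerAngle` also runs over equal neighbours, which contribute the angle `0`.
  have hself : ∀ x ∈ X.wheelTriangle p v a, X.star.graph.Adj (Sum.inl v) x →
      EuclideanGeometry.angle (dstar.pos (X.wheelTriangle p v a) x)
        (dstar.pos (X.wheelTriangle p v a) (Sum.inl v))
        (dstar.pos (X.wheelTriangle p v a) x) ≤ 3 * Real.pi / 10 := fun x hx hvx => by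
    rw [EuclideanGeometry.angle_self_of_ne (EuclideanStructure.pos_ne hcell hx hvm hvx.ne')]
    positivity
  have hmem : ∀ x ∈ X.wheelTriangle p v a, X.star.graph.Adj (Sum.inl v) x →
      x = Sum.inr p ∨ x = Sum.inl a := fun x hx hvx => by
    rcases mem_wheelTriangle.1 hx with h | h | h
    · exact Or.inl h
    · exact absurd h hvx.ne'
    · exact Or.inr h
  have hx' := hself x hx hvx
  rcases hmem x hx hvx with rfl | rfl <;> rcases hmem y hy hvy with rfl | rfl
  · exact hx'
  · exact hang.le
  · rw [EuclideanGeometry.angle_comm]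
    exact hang.le
  · exact hx'

theorem cornerAngle_oldTriangle_le {d : X.EuclideanStructure} {dstar : X.star.EuclideanStructure}
    (hstar : X.IsStarMetric d dstar) {t : Finset V} (ht : t ∈ X.triangles) {v : V} (hv : v ∈ t) :
    dstar.cornerAngle (X.oldTriangle t) (Sum.inl v) ≤ ENNReal.ofReal (Real.pi / 3) := by
  have hcell : X.oldTriangle t ∈ X.star.cells := mem_star_cells (Or.inl ⟨t, ht, rfl⟩)
  refine iSup₂_le fun x hx => iSup₂_le fun y hy => iSup₂_le fun hvx hvy =>
    ENNReal.ofReal_le_ofReal ?_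
  have hvm := (mem_oldTriangle (X := X)).2 ⟨v, hv, rfl⟩
  have hxv := EuclideanStructure.pos_ne (E := dstar) hcell hx hvm hvx.ne'
  rcases eq_or_ne x y with rfl | hxy
  · rw [EuclideanGeometry.angle_self_of_ne hxv]
    positivity
  obtain ⟨a, ha, rfl⟩ := mem_oldTriangle.1 hx
  obtain ⟨b, hb, rfl⟩ := mem_oldTriangle.1 hy
  have hva : v ≠ a := fun h => hvx.ne (congrArg _ h)
  have hvb : v ≠ b := fun h => hvy.ne (congrArg _ h)
  have hab : a ≠ b := fun h => hxy (congrArg _ h)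
  have h₁ := hstar.equilateral t ht v hv a ha b hb hva hvb
  have h₂ := hstar.equilateral t ht a ha v hv b hb hva.symm hab
  refine (InnerProductGeometry.angle_eq_pi_div_three (vsub_ne_zero.2 hxv) ?_ ?_).le
  · rw [← dist_eq_norm_vsub, ← dist_eq_norm_vsub, dist_comm, h₁, dist_comm]
  · rw [vsub_sub_vsub_cancel_right, ← dist_eq_norm_vsub, ← dist_eq_norm_vsub, h₂]

theorem cornerAngle_star_le {d : X.EuclideanStructure} {dstar : X.star.EuclideanStructure}
    (hstar : X.IsStarMetric d dstar) {τ : Finset X.StarVertex} (hτ : τ ∈ X.star.triangles) {v : V}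
    (hv : Sum.inl v ∈ τ) :
    dstar.cornerAngle τ (Sum.inl v) ≤ ENNReal.ofReal (Real.pi / 3) := by
  have hle : ENNReal.ofReal (3 * Real.pi / 10) ≤ ENNReal.ofReal (Real.pi / 3) :=
    ENNReal.ofReal_le_ofReal (by linarith [Real.pi_pos])
  rcases hτ with ⟨t, ht, rfl⟩ | ⟨p, a, b, ha, hb, hab, rfl⟩
  · obtain ⟨w, hw, hwv⟩ := mem_oldTriangle.1 hv
    obtain rfl := Sum.inl_injective hwv
    exact cornerAngle_oldTriangle_le hstar ht hw
  · simp only [mem_wheelTriangle, Sum.inl.injEq, reduceCtorEq, false_or] at hv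
    rcases hv with rfl | rfl
    · exact (cornerAngle_wheelTriangle_le hstar p ha hb hab).trans hle
    · rw [wheelTriangle_comm]
      exact (cornerAngle_wheelTriangle_le hstar p hb ha hab.symm).trans hle

/-- If at most six triangles of the subdivision meet at a vertex of a pentagon, then the sum of
their angles is less than `2π`. -/
theorem exists_angleSum_star_le {d : X.EuclideanStructure} {dstar : X.star.EuclideanStructure}
    (hstar : X.IsStarMetric d dstar) {v : V} {p : Finset V} (hp : p ∈ X.pentagons) (hv : v ∈ p)
    (hfin : {τ | τ ∈ X.star.triangles ∧ Sum.inl v ∈ τ}.Finite)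
    (hcard : hfin.toFinset.card ≤ 6) :
    ∃ s < 2 * Real.pi, dstar.angleSum (Sum.inl v) ≤ ENNReal.ofReal s := by
  classical
  obtain ⟨a, ha, hva, hmem⟩ := exists_wheelTriangle_mem hp hv
  set τ₀ := X.wheelTriangle ⟨p, hp⟩ v a
  have hπ := Real.pi_pos
  -- The one triangle `τ₀` from the pentagon makes the bound `6 · π/3` strict.
  set b : Finset X.StarVertex → ℝ := fun τ => if τ = τ₀ then 3 * Real.pi / 10 else Real.pi / 3
    with hb
  have hb₀ : ∀ τ, 0 ≤ b τ := fun τ => by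
    simp only [hb]
    split_ifs <;> positivity
  refine ⟨∑ τ ∈ hfin.toFinset, b τ, ?_, ?_⟩
  · have hlt : ∑ τ ∈ hfin.toFinset, b τ < ∑ τ ∈ hfin.toFinset, Real.pi / 3 := by
      refine Finset.sum_lt_sum (fun τ _ => ?_) ⟨τ₀, by simpa using hmem, ?_⟩
      · simp only [hb]
        split_ifs <;> linarith
      · simp only [hb, if_true]
        linarith
    rw [Finset.sum_const, nsmul_eq_mul] at hlt
    have : (hfin.toFinset.card : ℝ) ≤ 6 := by exact_mod_cast hcard
    nlinarith
  · rw [ENNReal.ofReal_sum_of_nonneg fun τ _ => hb₀ τ, EuclideanStructure.angleSum]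
    have hset : ∀ τ, (τ ∈ X.star.twoCells ∧ Sum.inl v ∈ τ) ↔ τ ∈ hfin.toFinset := fun τ => by
      simp [twoCells, star]
    rw [← Finset.tsum_subtype]
    refine le_trans (le_of_eq ((Equiv.subtypeEquivRight hset).tsum_eq
      fun τ : {τ // τ ∈ hfin.toFinset} => dstar.cornerAngle τ.1 (Sum.inl v))) ?_
    refine ENNReal.tsum_le_tsum fun τ => ?_
    have hτ : τ.1 ∈ X.star.triangles ∧ Sum.inl v ∈ τ.1 := hfin.mem_toFinset.1 τ.2
    simp only [hb]
    split_ifs with h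
    · rw [h]
      exact cornerAngle_wheelTriangle_le hstar ⟨p, hp⟩ hv ha hva
    · exact cornerAngle_star_le hstar hτ.1 hτ.2

end TrianglePentagonComplex

theorem theorem3p6 {V : Type*} (X : TrianglePentagonComplex V)
    (d : X.EuclideanStructure) [MetricSpace d.Realization]
    (hd : ∀ P Q : d.Realization, edist P Q = d.intrinsicEDist P Q)
    (hcat : IsCAT0 d.Realization)
    (dstar : X.star.EuclideanStructure) (hstar : X.IsStarMetric d dstar)
    (v : V) (hv : X.IsInterior v)
    (p : Finset V) (hp : p ∈ X.pentagons) (hvp : v ∈ p) :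
    7 ≤ combinatorialGirth X.starComplex (Sum.inl v) := by
  by_contra hlt
  have hle := (TrianglePentagonComplex.encard_star_triangles_le (X := X) v).trans_lt (not_le.1 hlt)
  have hfin : {τ | τ ∈ X.star.triangles ∧ Sum.inl v ∈ τ}.Finite :=
    Set.finite_of_encard_le_coe (k := 7) hle.le
  have hcard : hfin.toFinset.card ≤ 6 := by
    rw [hfin.encard_eq_coe_toFinset_card] at hle
    have : hfin.toFinset.card < 7 := by exact_mod_cast hle
    omega
  obtain ⟨s, hs, hsum⟩ :=
    TrianglePentagonComplex.exists_angleSum_star_le hstar hp hvp hfin hcard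
  rw [hstar.angleSum_eq v hv] at hsum
  have hfin' := TrianglePentagonComplex.finite_twoCells hfin
  obtain ⟨W, n, hn, hclosed, hinj⟩ := hv.exists_cycle hfin'
  have hne : W.c (n - 1) ≠ W.c 0 := fun h => by
    have := hinj (n - 1) (by omega) 0 (by omega) h
    omega
  have h₁ := W.two_pi_le_total hd hcat hfin' hn hclosed hne
  have h₂ := (W.ofReal_total_le_angleSum d hinj).trans hsum
  -- `ENNReal.ofReal` truncates negative numbers to `0`, so positivity of `s` is needed to compare
  -- the real numbers.
  have h₃ : 0 < s := by
    by_contra h₃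
    rw [ENNReal.ofReal_of_nonpos (not_lt.1 h₃), nonpos_iff_eq_zero, ENNReal.ofReal_eq_zero] at h₂
    linarith [Real.pi_pos]
  have h₄ := (ENNReal.ofReal_le_ofReal_iff h₃.le).1 h₂
  linarith
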